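/- Let $Q$ be a finite quiver (finite vertex set $I$, finitely many arrows; loops, multiple arrows and oriented cycles are allowed). A vector space over $\mathbb{F}_1$ is a finite pointed set $(V,0_V)$; a morphism $f\colon V\to W$ is a pointed map whose restriction to $V\setminus f^{-1}(0_W)$ is injective. Let $\mathrm{Rep}(Q)$ be the category of representations of $Q$ in vector spaces over $\mathbb{F}_1$. A subrepresentation $L\subseteq M$ is a family of pointed subsets stable under the arrows, $M/L$ is obtained from $M$ by collapsing $L$ to the base point at each vertex, and $M\oplus N$ is the pointed disjoint union at each vertex. A representation is indecomposable if it is non-zero and is not isomorphic to a direct sum of two non-zero representations. Let $\mathrm{Iso}(Q)$ be the set of isomorphism classes and let $\mathbf{H}_Q$ be the space of finitely supported functions $f\colon \mathrm{Iso}(Q)\to\mathbb{C}$; let $[M]$ denote the delta function at the class of $M$. Equip $\mathbf{H}_Q$ with the product $$(f\cdot g)(M)=\sum_{L\subseteq M} f(M/L)\,g(L),$$ the unit $[0]$, the coproduct $\Delta\colon \mathbf{H}_Q\to\mathbf{H}_Q\otimes\mathbf{H}_Q$, $\Delta(f)([M],[N])=f([M\oplus N])$, and the counit $\varepsilon(f)=f([0])$.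 Then: 1. $\mathbf{H}_Q$ is a cocommutative Hopf algebra over $\mathbb{C}$. It is graded and connected (the part of degree $0$ is $\mathbb{C}\cdot 1$), with product, unit, coproduct, counit and antipode homogeneous of degree $0$, for the grading that puts $[M]$ in degree its class in the effective cone $K_0^+(\mathrm{Rep}(Q))$ (the submonoid of $K_0(\mathrm{Rep}(Q))$ generated by the classes of representations), and also for the grading in which the degree of $[M]$ is its dimension vector in $\mathbb{Z}_{\ge 0}^{I}$. 2. The Lie algebra $\mathfrak{n}_Q$ of primitive elements of $\mathbf{H}_Q$, with the commutator bracket, is the linear span of the elements $[M]$ with $M$ indecomposable. It is pro-nilpotent in the following sense: it has a decreasing sequence of ideals with zero intersection whose quotients are finite-dimensional nilpotent Lie algebras. 3. The inclusion $\mathfrak{n}_Q\hookrightarrow\mathbf{H}_Q$ extends to an isomorphism of Hopf algebras $\mathrm{U}(\mathfrak{n}_Q)\cong\mathbf{H}_Q$, where $\mathrm{U}(\mathfrak{n}_Q)$ has its standard Hopf structure, in which the elements of $\mathfrak{n}_Q$ are primitive. -/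

import Mathlib

open CategoryTheory TensorProduct

universe u v

/-! ### Vector spaces over the field with one element -/

/-- A morphism `V ⟶ W` of vector spaces over `𝔽₁`. Such a vector space is a finite pointed set, whose
base point is written `0`; a morphism is a pointed map which is injective away from the preimage of
the base point. -/
@[ext]
structure F1Map (V W : Type) [Zero V] [Zero W] where
  toFun : V → W
  map_zero : toFun 0 = 0
  inj : ∀ x y, toFun x ≠ 0 → toFun x = toFun y → x = y

namespace F1Map

instance {V W : Type} [Zero V] [Zero W] : CoeFun (F1Map V W) (fun _ => V → W) := ⟨toFun⟩

/-- The identity map. -/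
def id (V : Type) [Zero V] : F1Map V V := ⟨fun x => x, rfl, fun _ _ _ h => h⟩

/-- Composition of maps. -/
def comp {U V W : Type} [Zero U] [Zero V] [Zero W] (g : F1Map V W) (f : F1Map U V) : F1Map U W where
  toFun x := g (f x)
  map_zero := by rw [f.map_zero, g.map_zero]
  inj x y hx h := by
    refine f.inj x y (fun h0 => hx ?_) (g.inj _ _ hx h)
    rw [h0, g.map_zero]

instance {V W : Type} [Zero V] [Zero W] [Finite V] [Finite W] : Finite (F1Map V W) :=
  Finite.of_injective F1Map.toFun (fun _ _ h => F1Map.ext h)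

end F1Map

/-- The direct sum of `V` and `W`, that is, the pointed disjoint union (the disjoint union with the two
base points identified), realized as the set of those pairs in `V × W` that have at least one
coordinate equal to the base point. -/
def F1Sum (V W : Type) [Zero V] [Zero W] : Type := {p : V × W // p.1 = 0 ∨ p.2 = 0}

instance {V W : Type} [Zero V] [Zero W] : Zero (F1Sum V W) := ⟨⟨(0, 0), Or.inl rfl⟩⟩

instance {V W : Type} [Zero V] [Zero W] [Finite V] [Finite W] : Finite (F1Sum V W) :=
  inferInstanceAs (Finite {p : V × W // p.1 = 0 ∨ p.2 = 0})

/-! ### Representations of a quiver over the field with one element -/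

/-- A representation of the quiver `I` in vector spaces over `𝔽₁`: a finite pointed set `V i` for each
vertex and a morphism for each arrow. -/
structure F1Rep (I : Type u) [Quiver.{v} I] where
  V : I → Type
  [zero : ∀ i, Zero (V i)]
  [finite : ∀ i, Finite (V i)]
  map : ∀ {i j : I}, (i ⟶ j) → F1Map (V i) (V j)

attribute [instance] F1Rep.zero F1Rep.finite

namespace F1Rep

variable {I : Type u} [Quiver.{v} I]

/-- A morphism of representations. -/
@[ext]
structure Hom (M N : F1Rep I) where
  app : ∀ i, F1Map (M.V i) (N.V i)
  comm : ∀ {i j : I} (h : i ⟶ j) (x : M.V i), app j (M.map h x) = N.map h (app i x)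

/-- The category of representations. -/
instance : Category (F1Rep I) where
  Hom := Hom
  id M := ⟨fun i => F1Map.id (M.V i), fun _ _ => rfl⟩
  comp f g := ⟨fun i => (g.app i).comp (f.app i), fun h x =>
    (congrArg (g.app _) (f.comm h x)).trans (g.comm h (f.app _ x))⟩

/-- The zero representation. -/
def zeroRep (I : Type u) [Quiver.{v} I] : F1Rep I where
  V _ := Unit
  map _ := F1Map.id Unit

/-- The direct sum of two representations: the direct sum of pointed sets at each vertex and the
induced map at each arrow. -/
def directSum (M N : F1Rep I) : F1Rep I where
  V i := F1Sum (M.V i) (N.V i)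
  map {i j} h :=
    { toFun := fun p => ⟨(M.map h p.1.1, N.map h p.1.2), p.2.imp
        (fun e => by rw [e]; exact (M.map h).map_zero) (fun e => by rw [e]; exact (N.map h).map_zero)⟩
      map_zero := Subtype.ext (Prod.ext (M.map h).map_zero (N.map h).map_zero)
      inj := by
        rintro ⟨⟨x, y⟩, hp⟩ ⟨⟨x', y'⟩, hq⟩ h0 e
        have e1 : M.map h x = M.map h x' := congrArg (fun p => p.1.1) e
        have e2 : N.map h y = N.map h y' := congrArg (fun p => p.1.2) e
        have h0' : ¬ (M.map h x = 0 ∧ N.map h y = 0) := fun hh => h0 (Subtype.ext (Prod.ext hh.1 hh.2))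
        have mz := (M.map h).map_zero
        have nz := (N.map h).map_zero
        have mi := (M.map h).inj x x'
        have ni := (N.map h).inj y y'
        refine Subtype.ext (Prod.ext ?_ ?_) <;> grind }

/-- A subrepresentation: a pointed subset at each vertex, stable under all arrows. -/
@[ext]
structure Sub (M : F1Rep I) where
  carrier : ∀ i, Set (M.V i)
  zero_mem : ∀ i, 0 ∈ carrier i
  map_mem : ∀ {i j : I} (h : i ⟶ j) {x : M.V i}, x ∈ carrier i → M.map h x ∈ carrier j

instance [Finite I] (M : F1Rep I) : Finite (Sub M) :=
  Finite.of_injective Sub.carrier (fun _ _ h => Sub.ext h)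

namespace Sub

variable {M : F1Rep I}

instance (L : Sub M) (i : I) : Zero (L.carrier i) := ⟨⟨0, L.zero_mem i⟩⟩

/-- A subrepresentation as a representation. -/
def toRep (L : Sub M) : F1Rep I where
  V i := L.carrier i
  map h :=
    { toFun := fun x => ⟨M.map h x.1, L.map_mem h x.2⟩
      map_zero := Subtype.ext (M.map h).map_zero
      inj := fun x y h0 e => Subtype.ext ((M.map h).inj x.1 y.1
        (fun e0 => h0 (Subtype.ext e0)) (congrArg Subtype.val e)) }

/-- The equivalence relation on `M.V i` that collapses the subset `L.carrier i` to one point. -/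
def collapse (L : Sub M) (i : I) : Setoid (M.V i) where
  r x y := x = y ∨ (x ∈ L.carrier i ∧ y ∈ L.carrier i)
  iseqv := ⟨fun _ => Or.inl rfl, by grind, by grind⟩

instance (L : Sub M) (i : I) : Zero (Quotient (L.collapse i)) := ⟨Quotient.mk _ 0⟩

/-- The quotient of `M` by a subrepresentation `L`, which at each vertex is the pointed set obtained
by collapsing the subset `L.carrier i` to a point. -/
def quot (L : Sub M) : F1Rep I where
  V i := Quotient (L.collapse i)
  map {i j} h :=
    { toFun := Quotient.map (M.map h) (by
        rintro x y (e | ⟨hx, hy⟩)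
        · exact Or.inl (by rw [e])
        · exact Or.inr ⟨L.map_mem h hx, L.map_mem h hy⟩)
      map_zero := congrArg (Quotient.mk (L.collapse j)) (M.map h).map_zero
      inj := by
        intro x y
        induction x using Quotient.inductionOn
        induction y using Quotient.inductionOn
        rename_i x y
        intro h0 e
        rcases Quotient.exact e with e | ⟨hx, hy⟩
        · refine congrArg _ ((M.map h).inj x y (fun e0 => h0 ?_) e)
          exact congrArg (Quotient.mk (L.collapse j)) e0
        · exact (h0 (Quotient.sound (Or.inr ⟨hx, L.zero_mem j⟩))).elim }

end Sub

/-! ### Isomorphisms: helper facts -/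

theorem isIsomorphic_of_bijective {M N : F1Rep I} (φ : Hom M N)
    (hφ : ∀ i, Function.Bijective (φ.app i).toFun) : Nonempty (M ≅ N) := by
  let e : ∀ i, M.V i ≃ N.V i := fun i => Equiv.ofBijective _ (hφ i)
  let ψ : Hom N M :=
    { app := fun i =>
        { toFun := (e i).symm
          map_zero := (e i).symm_apply_eq.2 (φ.app i).map_zero.symm
          inj := fun x y _ h => (e i).symm.injective h }
      comm := fun {i j} h x => by
        refine (e j).symm_apply_eq.2 ?_
        have := φ.comm h ((e i).symm x)
        refine Eq.trans ?_ this.symm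
        exact congrArg (N.map h).toFun ((e i).apply_symm_apply x).symm }
  refine ⟨⟨φ, ψ, ?_, ?_⟩⟩
  · exact Hom.ext (funext fun i => F1Map.ext (funext fun x => (e i).symm_apply_apply x))
  · exact Hom.ext (funext fun i => F1Map.ext (funext fun x => (e i).apply_symm_apply x))

theorem hom_inv_apply {M N : F1Rep I} (e : M ≅ N) (i : I) (x : M.V i) :
    Hom.app e.inv i (Hom.app e.hom i x) = x :=
  congrArg (fun f : Hom M M => (f.app i).toFun x) e.hom_inv_id

theorem inv_hom_apply {M N : F1Rep I} (e : M ≅ N) (i : I) (x : N.V i) :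
    Hom.app e.hom i (Hom.app e.inv i x) = x :=
  congrArg (fun f : Hom N N => (f.app i).toFun x) e.inv_hom_id

theorem bijective_of_iso {M N : F1Rep I} (e : M ≅ N) (i : I) :
    Function.Bijective (Hom.app e.hom i).toFun := by
  exact Function.bijective_iff_has_inverse.2
    ⟨(Hom.app e.inv i).toFun, hom_inv_apply e i, inv_hom_apply e i⟩

namespace Sub

/-- The inclusion of a subrepresentation. -/
def incl {M : F1Rep I} (L : Sub M) : Hom L.toRep M where
  app _ := ⟨fun x => x.1, rfl, fun _ _ _ h => Subtype.ext h⟩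
  comm _ _ := rfl

/-- The projection onto the quotient. -/
def proj {M : F1Rep I} (L : Sub M) : Hom M L.quot where
  app i := ⟨fun x => Quotient.mk (L.collapse i) x, rfl, fun x y h0 h => by
    rcases Quotient.exact h with e | ⟨hx, _⟩
    · exact e
    · exact (h0 (Quotient.sound (Or.inr ⟨hx, L.zero_mem i⟩))).elim⟩
  comm _ _ := rfl

theorem proj_surjective {M : F1Rep I} (L : Sub M) (i : I) :
    Function.Surjective (L.proj.app i).toFun := fun x => Quotient.exists_rep x

theorem proj_eq_zero {M : F1Rep I} (L : Sub M) (i : I) (x : M.V i) :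
    L.proj.app i x = 0 ↔ x ∈ L.carrier i := by
  constructor
  · intro h
    rcases Quotient.exact h with e | ⟨hx, _⟩
    · rw [e]; exact L.zero_mem i
    · exact hx
  · intro h
    exact Quotient.sound (Or.inr ⟨h, L.zero_mem i⟩)

/-- The preimage of a subrepresentation. -/
def comap {M N : F1Rep I} (φ : Hom M N) (K : Sub N) : Sub M where
  carrier i := {x | φ.app i x ∈ K.carrier i}
  zero_mem i := by
    change φ.app i 0 ∈ K.carrier i
    rw [(φ.app i).map_zero]; exact K.zero_mem i
  map_mem {i j} h {x} hx := by
    change φ.app j (M.map h x) ∈ K.carrier j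
    rw [φ.comm]; exact K.map_mem h hx

/-- The image of a subrepresentation. -/
def image {M N : F1Rep I} (φ : Hom M N) (K : Sub M) : Sub N where
  carrier i := (φ.app i).toFun '' K.carrier i
  zero_mem i := ⟨0, K.zero_mem i, (φ.app i).map_zero⟩
  map_mem {i j} h {x} := by
    rintro ⟨y, hy, rfl⟩
    exact ⟨M.map h y, K.map_mem h hy, φ.comm h y⟩

theorem quot_iso {M N : F1Rep I} (L : Sub M) (p : Hom M N)
    (hp : ∀ i, Function.Surjective (p.app i).toFun)
    (hL : ∀ i x, p.app i x = 0 ↔ x ∈ L.carrier i) : Nonempty (L.quot ≅ N) := by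
  refine isIsomorphic_of_bijective (M := L.quot) (N := N)
    { app := fun i =>
        { toFun := Quotient.lift (p.app i).toFun (by
            rintro x y (e | ⟨hx, hy⟩)
            · rw [e]
            · exact ((hL i x).2 hx).trans ((hL i y).2 hy).symm)
          map_zero := (p.app i).map_zero
          inj := ?_ }
      comm := ?_ } ?_
  · intro x y
    induction x using Quotient.inductionOn
    induction y using Quotient.inductionOn
    rename_i x y
    intro h0 e
    exact congrArg _ ((p.app i).inj x y h0 e)
  · intro i j h x
    induction x using Quotient.inductionOn
    exact p.comm h _
  · intro i
    constructor
    · intro x y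
      induction x using Quotient.inductionOn
      induction y using Quotient.inductionOn
      rename_i x y
      intro e
      by_cases h0 : p.app i x = 0
      · have h1 : p.app i y = 0 := Eq.trans (Eq.symm e) h0
        exact Quotient.sound (Or.inr ⟨(hL i x).1 h0, (hL i y).1 h1⟩)
      · exact congrArg _ ((p.app i).inj x y h0 e)
    · intro y
      obtain ⟨x, hx⟩ := hp i y
      exact ⟨Quotient.mk _ x, hx⟩

theorem toRep_iso {M N : F1Rep I} (L : Sub M) (j : Hom N M)
    (hj : ∀ i, Function.Injective (j.app i).toFun)
    (hL : ∀ i, Set.range (j.app i).toFun = L.carrier i) : Nonempty (N ≅ L.toRep) := by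
  refine isIsomorphic_of_bijective (M := N) (N := L.toRep)
    { app := fun i =>
        { toFun := fun x => ⟨j.app i x, by rw [← hL]; exact ⟨x, rfl⟩⟩
          map_zero := Subtype.ext (j.app i).map_zero
          inj := fun x y _ e => hj i (congrArg Subtype.val e) }
      comm := fun h x => Subtype.ext (j.comm h x) } ?_
  intro i
  constructor
  · intro x y e
    exact hj i (congrArg Subtype.val e)
  · rintro ⟨y, hy⟩
    rw [← hL] at hy
    obtain ⟨x, hx⟩ := hy
    exact ⟨x, Subtype.ext hx⟩

/-- Isomorphic representations have corresponding subrepresentations. -/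
def equivOfIso {M N : F1Rep I} (e : M ≅ N) : Sub M ≃ Sub N where
  toFun L := comap e.inv L
  invFun L := comap e.hom L
  left_inv L := by
    ext i x
    change Hom.app e.inv i (Hom.app e.hom i x) ∈ L.carrier i ↔ _
    rw [hom_inv_apply]
  right_inv L := by
    ext i x
    change Hom.app e.hom i (Hom.app e.inv i x) ∈ L.carrier i ↔ _
    rw [inv_hom_apply]

theorem quot_comap_iso {M N : F1Rep I} (φ : Hom M N)
    (hφ : ∀ i, Function.Surjective (φ.app i).toFun) (K : Sub N) :
    Nonempty ((comap φ K).quot ≅ K.quot) := by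
  let p : M ⟶ K.quot := (show M ⟶ N from φ) ≫ (show N ⟶ K.quot from K.proj)
  exact quot_iso _ p (fun i => (K.proj_surjective i).comp (hφ i))
    (fun i x => K.proj_eq_zero i (φ.app i x))

theorem toRep_comap_iso {M N : F1Rep I} (e : M ≅ N) (L : Sub M) :
    Nonempty (L.toRep ≅ (equivOfIso e L).toRep) := by
  let j : L.toRep ⟶ N := (show L.toRep ⟶ M from L.incl) ≫ e.hom
  refine toRep_iso _ j (fun i => (bijective_of_iso e i).1.comp Subtype.val_injective) fun i => ?_
  ext y
  constructor
  · rintro ⟨x, rfl⟩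
    change Hom.app e.inv i (Hom.app e.hom i x.1) ∈ L.carrier i
    rw [hom_inv_apply]; exact x.2
  · intro hy
    exact ⟨⟨_, hy⟩, inv_hom_apply e i y⟩

end Sub

theorem directSum_congr {M M' N N' : F1Rep I} (e : M ≅ M') (e' : N ≅ N') :
    Nonempty (M.directSum N ≅ M'.directSum N') := by
  have b := bijective_of_iso e
  have b' := bijective_of_iso e'
  have z := fun i => (Hom.app e.hom i).map_zero
  have z' := fun i => (Hom.app e'.hom i).map_zero
  have key : ∀ i, Function.Injective (fun p : F1Sum (M.V i) (N.V i) =>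
      (⟨(Hom.app e.hom i p.1.1, Hom.app e'.hom i p.1.2), p.2.imp
        (fun h => by rw [h]; exact z i) (fun h => by rw [h]; exact z' i)⟩ :
        F1Sum (M'.V i) (N'.V i))) := fun i p q h =>
    Subtype.ext (Prod.ext ((b i).1 (congrArg (fun p => p.1.1) h))
      ((b' i).1 (congrArg (fun p => p.1.2) h)))
  refine isIsomorphic_of_bijective (M := M.directSum N) (N := M'.directSum N')
    { app := fun i => ⟨_, Subtype.ext (Prod.ext (z i) (z' i)), fun p q _ h => key i h⟩
      comm := fun h p => Subtype.ext (Prod.ext (Hom.comm e.hom h p.1.1) (Hom.comm e'.hom h p.1.2)) }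
    fun i => ⟨key i, ?_⟩
  rintro ⟨⟨x, y⟩, h⟩
  obtain ⟨x, rfl⟩ := (b i).2 x
  obtain ⟨y, rfl⟩ := (b' i).2 y
  exact ⟨⟨(x, y), h.imp (fun h => (b i).1 (h.trans (z i).symm))
    (fun h => (b' i).1 (h.trans (z' i).symm))⟩, rfl⟩

theorem directSum_comm (M N : F1Rep I) : Nonempty (M.directSum N ≅ N.directSum M) :=
  isIsomorphic_of_bijective (M := M.directSum N) (N := N.directSum M)
    { app := fun _ => ⟨fun p => ⟨(p.1.2, p.1.1), p.2.symm⟩, rfl, fun _ _ _ h =>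
        Subtype.ext (Prod.ext (congrArg (fun p => p.1.2) h) (congrArg (fun p => p.1.1) h))⟩
      comm := fun _ _ => rfl }
    fun _ => ⟨fun _ _ h => Subtype.ext (Prod.ext (congrArg (fun p => p.1.2) h)
      (congrArg (fun p => p.1.1) h)), fun p => ⟨⟨(p.1.2, p.1.1), p.2.symm⟩, rfl⟩⟩

theorem directSum_assoc (M N P : F1Rep I) :
    Nonempty ((M.directSum N).directSum P ≅ M.directSum (N.directSum P)) := by
  have key : ∀ i, Function.Injective (fun p : F1Sum (F1Sum (M.V i) (N.V i)) (P.V i) =>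
      (⟨(p.1.1.1.1, ⟨(p.1.1.1.2, p.1.2), by
        have := p.2
        rcases p with ⟨⟨⟨⟨a, b⟩, h⟩, c⟩, h' | h'⟩
        · exact Or.inl (congrArg (fun p => p.1.2) h')
        · exact Or.inr h'⟩), by
        rcases p with ⟨⟨⟨⟨a, b⟩, h⟩, c⟩, h' | h'⟩
        · exact Or.inl (congrArg (fun p => p.1.1) h')
        · rcases h with h | h
          · exact Or.inl h
          · exact Or.inr (Subtype.ext (Prod.ext h h'))⟩ :
        F1Sum (M.V i) (F1Sum (N.V i) (P.V i)))) := fun i p q h =>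
    Subtype.ext (Prod.ext (Subtype.ext (Prod.ext (congrArg (fun p => p.1.1) h)
      (congrArg (fun p => p.1.2.1.1) h))) (congrArg (fun p => p.1.2.1.2) h))
  refine isIsomorphic_of_bijective (M := (M.directSum N).directSum P)
    (N := M.directSum (N.directSum P))
    { app := fun i => ⟨_, rfl, fun p q _ h => key i h⟩
      comm := fun _ _ => rfl } fun i => ⟨key i, ?_⟩
  rintro ⟨⟨a, ⟨⟨b, c⟩, h⟩⟩, h'⟩
  refine ⟨⟨(⟨(a, b), ?_⟩, c), ?_⟩, rfl⟩
  · rcases h' with h' | h'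
    · exact Or.inl h'
    · exact Or.inr (congrArg (fun p => p.1.1) h')
  · rcases h' with h' | h'
    · rcases h with h | h
      · exact Or.inl (Subtype.ext (Prod.ext h' h))
      · exact Or.inr h
    · exact Or.inr (congrArg (fun p => p.1.2) h')

theorem directSum_zero (M : F1Rep I) : Nonempty (M.directSum (zeroRep I) ≅ M) :=
  isIsomorphic_of_bijective (M := M.directSum (zeroRep I)) (N := M)
    { app := fun _ => ⟨fun p => p.1.1, rfl, fun _ _ _ h => Subtype.ext (Prod.ext h rfl)⟩
      comm := fun _ _ => rfl }
    fun _ => ⟨fun _ _ h => Subtype.ext (Prod.ext h rfl), fun x => ⟨⟨(x, ()), Or.inr rfl⟩, rfl⟩⟩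

end F1Rep

open F1Rep

/-- Isomorphism classes of representations of the quiver `I` over `𝔽₁`. -/
def IsoClass (I : Type u) [Quiver.{v} I] : Type (max u v 1) :=
  Quotient (isIsomorphicSetoid (F1Rep I))

namespace IsoClass

variable {I : Type u} [Quiver.{v} I]

/-- The isomorphism class of a representation. -/
def mk (M : F1Rep I) : IsoClass I := Quotient.mk (isIsomorphicSetoid (F1Rep I)) M

theorem mk_eq {M N : F1Rep I} : mk M = mk N ↔ Nonempty (M ≅ N) :=
  ⟨fun h => Quotient.exact h, fun h => Quotient.sound h⟩

theorem ind {p : IsoClass I → Prop} (h : ∀ M, p (mk M)) (c : IsoClass I) : p c :=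
  Quotient.ind h c

instance : Zero (IsoClass I) := ⟨mk (zeroRep I)⟩

/-- Addition of isomorphism classes is the direct sum of representations. -/
instance : Add (IsoClass I) :=
  ⟨Quotient.map₂ F1Rep.directSum fun _ _ ⟨e⟩ _ _ ⟨e'⟩ => directSum_congr e e'⟩

theorem mk_add (M N : F1Rep I) : mk M + mk N = mk (M.directSum N) := rfl

instance : AddCommMonoid (IsoClass I) where
  add_assoc a b c := by
    induction a using ind; induction b using ind; induction c using ind
    exact mk_eq.2 (directSum_assoc _ _ _)
  add_comm a b := by
    induction a using ind; induction b using ind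
    exact mk_eq.2 (directSum_comm _ _)
  zero_add a := by
    induction a using ind with | _ M
    obtain ⟨e⟩ := directSum_comm (zeroRep I) M
    obtain ⟨e'⟩ := directSum_zero M
    exact mk_eq.2 ⟨e.trans e'⟩
  add_zero a := by
    induction a using ind
    exact mk_eq.2 (directSum_zero _)
  nsmul := nsmulRec

end IsoClass

/-! ### Dimension vectors and finiteness -/

namespace F1Rep

variable {I : Type u} [Quiver.{v} I]

/-- The dimension vector: the number of non-zero elements at each vertex. -/
noncomputable def dimVec (M : F1Rep I) (i : I) : ℕ := Nat.card (M.V i) - 1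

theorem card_eq (M : F1Rep I) (i : I) : Nat.card (M.V i) = M.dimVec i + 1 := by
  have : 0 < Nat.card (M.V i) := Nat.card_pos
  simp only [dimVec]; omega

theorem dimVec_congr {M N : F1Rep I} (e : M ≅ N) : M.dimVec = N.dimVec := by
  funext i
  simp only [dimVec, Nat.card_congr (Equiv.ofBijective _ (bijective_of_iso e i))]

theorem dimVec_le {M : F1Rep I} (L : Sub M) : M.dimVec ≤ L.quot.dimVec + L.toRep.dimVec := by
  classical
  intro i
  let π : {x // x ∉ L.carrier i} → {q : L.quot.V i // q ≠ 0} := fun x =>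
    ⟨L.proj.app i x.1, fun h => x.2 ((L.proj_eq_zero i x.1).1 h)⟩
  have hπ : Function.Injective π := fun x y h =>
    Subtype.ext ((L.proj.app i).inj x.1 y.1 (π x).2 (congrArg Subtype.val h))
  have h1 : Nat.card {x // x ∉ L.carrier i} ≤ Nat.card {q : L.quot.V i // q ≠ 0} :=
    Nat.card_le_card_of_injective π hπ
  have h2 : Nat.card {q : L.quot.V i // q ≠ 0} + 1 = Nat.card (L.quot.V i) := by
    have h : Nat.card {q : L.quot.V i // q = 0} + Nat.card {q : L.quot.V i // q ≠ 0}
        = Nat.card (L.quot.V i) := by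
      rw [← Nat.card_sum]; exact Nat.card_congr (Equiv.sumCompl _)
    rwa [Nat.card_unique, add_comm] at h
  have h3 : Nat.card {x // x ∈ L.carrier i} + Nat.card {x // x ∉ L.carrier i}
      = Nat.card (M.V i) := by
    rw [← Nat.card_sum]; exact Nat.card_congr (Equiv.sumCompl _)
  have h4 : Nat.card {x // x ∈ L.carrier i} = Nat.card (L.toRep.V i) := rfl
  have := M.card_eq i
  have := L.quot.card_eq i
  have := L.toRep.card_eq i
  change M.dimVec i ≤ L.quot.dimVec i + L.toRep.dimVec i
  omega

/-- A representation with underlying pointed sets `{0, …, d i}`. -/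
def std (d : I → ℕ) (m : ∀ i j : I, (i ⟶ j) → F1Map (Fin (d i + 1)) (Fin (d j + 1))) : F1Rep I where
  V i := Fin (d i + 1)
  map {i j} h := m i j h

theorem exists_std (M : F1Rep I) :
    ∃ m : ∀ i j : I, (i ⟶ j) → F1Map (Fin (M.dimVec i + 1)) (Fin (M.dimVec j + 1)),
      Nonempty (M ≅ std M.dimVec m) := by
  have : ∀ i, ∃ e : M.V i ≃ Fin (M.dimVec i + 1), e 0 = 0 := fun i => by
    classical
    let e := Finite.equivFinOfCardEq (M.card_eq i)
    exact ⟨e.trans (Equiv.swap (e 0) 0), by simp⟩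
  choose e he using this
  refine ⟨fun i j h => ⟨fun x => e j (M.map h ((e i).symm x)), ?_, fun x y h0 hh => ?_⟩,
    isIsomorphic_of_bijective (M := M) (N := std _ _)
      { app := fun i => ⟨e i, he i, fun _ _ _ h => (e i).injective h⟩
        comm := fun {i j} h x => ?_ } fun i => (e i).bijective⟩
  · rw [(e i).symm_apply_eq.2 (he i).symm, (M.map h).map_zero, he]
  · refine (e i).symm.injective ((M.map h).inj _ _ (fun h1 => h0 ?_) ((e j).injective hh))
    change e j (M.map h ((e i).symm x)) = 0
    rw [show M.map h ((e i).symm x) = 0 from h1, he]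
  · change e j (M.map h x) = e j (M.map h ((e i).symm (e i x)))
    rw [Equiv.symm_apply_apply]

end F1Rep

namespace IsoClass

variable {I : Type u} [Quiver.{v} I]

/-- The dimension vector of an isomorphism class. -/
noncomputable def dimVec : IsoClass I → I → ℕ :=
  Quotient.lift F1Rep.dimVec fun _ _ ⟨e⟩ => dimVec_congr e

theorem dimVec_mk (M : F1Rep I) : (mk M).dimVec = M.dimVec := rfl

theorem finite_dimVec_le [Finite I] [∀ i j : I, Finite (i ⟶ j)] (b : I → ℕ) :
    {c : IsoClass I | c.dimVec ≤ b}.Finite := by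
  let Code := Σ d : ∀ i, Fin (b i + 1),
    ∀ i j : I, (i ⟶ j) → F1Map (Fin ((d i : ℕ) + 1)) (Fin ((d j : ℕ) + 1))
  refine (Set.finite_range (fun c : Code => mk (std (fun i => (c.1 i : ℕ)) c.2))).subset ?_
  intro c
  induction c using ind with | _ M
  intro hM
  obtain ⟨m, hm⟩ := M.exists_std
  exact ⟨⟨fun i => ⟨M.dimVec i, Nat.lt_succ_of_le (hM i)⟩, m⟩, (mk_eq.2 hm).symm⟩

theorem finite_extensions [Finite I] [∀ i j : I, Finite (i ⟶ j)] {s t : Set (IsoClass I)}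
    (hs : s.Finite) (ht : t.Finite) :
    {c | ∃ (M : F1Rep I) (L : Sub M), c = mk M ∧ mk L.quot ∈ s ∧ mk L.toRep ∈ t}.Finite := by
  refine ((hs.prod ht).biUnion fun p _ => finite_dimVec_le (p.1.dimVec + p.2.dimVec)).subset ?_
  rintro c ⟨M, L, rfl, h1, h2⟩
  exact Set.mem_biUnion (x := (mk L.quot, mk L.toRep)) ⟨h1, h2⟩ (dimVec_le L)

theorem finite_add_eq [Finite I] (c : IsoClass I) : {p : IsoClass I × IsoClass I | p.1 + p.2 = c}.Finite := by
  induction c using ind with | _ M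
  refine ((Set.finite_range fun L : Sub M => mk L.toRep).prod
    (Set.finite_range fun L : Sub M => mk L.toRep)).subset ?_
  rintro ⟨a, b⟩
  induction a using ind with | _ A
  induction b using ind with | _ B
  intro h
  obtain ⟨e⟩ := mk_eq.1 (show mk (A.directSum B) = mk M from h)
  let jA : Hom A (A.directSum B) :=
    { app := fun i => ⟨fun x => ⟨(x, 0), Or.inr rfl⟩, rfl, fun _ _ _ h => congrArg (fun p => p.1.1) h⟩
      comm := fun h _ => Subtype.ext (Prod.ext rfl (B.map h).map_zero.symm) }
  let jB : Hom B (A.directSum B) :=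
    { app := fun i => ⟨fun x => ⟨(0, x), Or.inl rfl⟩, rfl, fun _ _ _ h => congrArg (fun p => p.1.2) h⟩
      comm := fun h _ => Subtype.ext (Prod.ext (A.map h).map_zero.symm rfl) }
  have key : ∀ (C : F1Rep I) (j : Hom C (A.directSum B)),
      (∀ i, Function.Injective (j.app i).toFun) → ∃ L : Sub M, mk L.toRep = mk C := fun C j hj => by
    let k : C ⟶ M := (show C ⟶ A.directSum B from j) ≫ e.hom
    let L : Sub M := ⟨fun i => Set.range (Hom.app k i).toFun, fun i => ⟨0, (Hom.app k i).map_zero⟩,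
      by
        rintro i j h _ ⟨x, rfl⟩
        exact ⟨C.map h x, Hom.comm k h x⟩⟩
    exact ⟨L, (mk_eq.2 (Sub.toRep_iso L k (fun i => (bijective_of_iso e i).1.comp (hj i))
      fun _ => rfl)).symm⟩
  exact ⟨key A jA fun i _ _ h => congrArg (fun p => p.1.1) h,
    key B jB fun i _ _ h => congrArg (fun p => p.1.2) h⟩

end IsoClass

/-! ### The Hall algebra -/

/-- The underlying vector space of the Hall algebra: finitely supported complex functions on the set of
isomorphism classes. -/
def HallAlgebra (I : Type u) [Quiver.{v} I] : Type (max u v 1) := IsoClass I →₀ ℂ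

namespace HallAlgebra

variable {I : Type u} [Quiver.{v} I]

noncomputable instance : AddCommGroup (HallAlgebra I) :=
  inferInstanceAs (AddCommGroup (IsoClass I →₀ ℂ))

noncomputable instance : Module ℂ (HallAlgebra I) :=
  inferInstanceAs (Module ℂ (IsoClass I →₀ ℂ))

instance : FunLike (HallAlgebra I) (IsoClass I) ℂ :=
  inferInstanceAs (FunLike (IsoClass I →₀ ℂ) (IsoClass I) ℂ)

/-- The identification with finitely supported functions. -/
noncomputable def toFinsupp : HallAlgebra I ≃ₗ[ℂ] (IsoClass I →₀ ℂ) := LinearEquiv.refl ℂ _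

/-- The delta function `[M]` of an isomorphism class. -/
noncomputable def delta (c : IsoClass I) : HallAlgebra I := toFinsupp.symm (Finsupp.single c 1)

theorem ext {f g : HallAlgebra I} (h : ∀ M, f (IsoClass.mk M) = g (IsoClass.mk M)) : f = g :=
  Finsupp.ext fun c => IsoClass.ind (p := fun c => f c = g c) h c

theorem add_apply (f g : HallAlgebra I) (c : IsoClass I) : (f + g) c = f c + g c := rfl

theorem smul_apply (a : ℂ) (f : HallAlgebra I) (c : IsoClass I) : (a • f) c = a * f c := rfl

theorem zero_apply (c : IsoClass I) : (0 : HallAlgebra I) c = 0 := rfl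

theorem finite_support (f : HallAlgebra I) : {c | f c ≠ 0}.Finite :=
  Finsupp.hasFiniteSupport (toFinsupp f)

/-- The value at `M` of the convolution product: the sum over all subrepresentations `L` of `M` of
`f(M/L) g(L)`. -/
noncomputable def conv (f g : HallAlgebra I) : IsoClass I → ℂ :=
  Quotient.lift (fun M : F1Rep I => ∑ᶠ L : Sub M, f (IsoClass.mk L.quot) * g (IsoClass.mk L.toRep))
    fun M N ⟨e⟩ => by
      refine finsum_eq_of_bijective (Sub.equivOfIso e) (Sub.equivOfIso e).bijective fun L => ?_
      have h1 : IsoClass.mk L.quot = IsoClass.mk (Sub.equivOfIso e L).quot :=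
        IsoClass.mk_eq.2 
          ((Sub.quot_comap_iso e.inv (fun i => (bijective_of_iso e.symm i).2) L).map Iso.symm)
      have h2 : IsoClass.mk L.toRep = IsoClass.mk (Sub.equivOfIso e L).toRep :=
        IsoClass.mk_eq.2 (Sub.toRep_comap_iso e L)
      rw [h1, h2]

theorem conv_mk (f g : HallAlgebra I) (M : F1Rep I) :
    conv f g (IsoClass.mk M) = ∑ᶠ L : Sub M, f (IsoClass.mk L.quot) * g (IsoClass.mk L.toRep) := rfl

/-- The `IsoClass I × IsoClass I`-coordinates of an element of the tensor square. -/
noncomputable def tensorEquiv :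
    HallAlgebra I ⊗[ℂ] HallAlgebra I ≃ₗ[ℂ] (IsoClass I × IsoClass I →₀ ℂ) :=
  (TensorProduct.congr toFinsupp toFinsupp).trans
    (finsuppTensorFinsupp' ℂ (IsoClass I) (IsoClass I))

theorem tensorEquiv_tmul (f g : HallAlgebra I) (a b : IsoClass I) :
    tensorEquiv (f ⊗ₜ[ℂ] g) (a, b) = f a * g b :=
  finsuppTensorFinsupp'_apply_apply ..

theorem tensor_ext {x y : HallAlgebra I ⊗[ℂ] HallAlgebra I}
    (h : ∀ a b, tensorEquiv x (a, b) = tensorEquiv y (a, b)) : x = y :=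
  tensorEquiv.injective (Finsupp.ext fun p => h p.1 p.2)

/-- Coordinates on the triple tensor product. -/
noncomputable def tensorEquiv₃ : HallAlgebra I ⊗[ℂ] (HallAlgebra I ⊗[ℂ] HallAlgebra I) ≃ₗ[ℂ]
    (IsoClass I × IsoClass I × IsoClass I →₀ ℂ) :=
  (TensorProduct.congr toFinsupp tensorEquiv).trans
    (finsuppTensorFinsupp' ℂ (IsoClass I) (IsoClass I × IsoClass I))

theorem tensorEquiv₃_tmul (f : HallAlgebra I) (x : HallAlgebra I ⊗[ℂ] HallAlgebra I)
    (p : IsoClass I × IsoClass I × IsoClass I) :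
    tensorEquiv₃ (f ⊗ₜ[ℂ] x) p = f p.1 * tensorEquiv x p.2 :=
  finsuppTensorFinsupp'_apply_apply ..

theorem ev₃_assoc_tmul (x : HallAlgebra I ⊗[ℂ] HallAlgebra I) (g : HallAlgebra I)
    (a b c : IsoClass I) :
    tensorEquiv₃ (TensorProduct.assoc ℂ _ _ _ (x ⊗ₜ[ℂ] g)) (a, b, c)
      = tensorEquiv x (a, b) * g c := by
  induction x with
  | zero => simp
  | tmul f h =>
    rw [TensorProduct.assoc_tmul, tensorEquiv₃_tmul, tensorEquiv_tmul, tensorEquiv_tmul, mul_assoc]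
  | add x y hx hy => simp only [TensorProduct.add_tmul, map_add, Finsupp.add_apply, hx, hy, add_mul]

section Finite

variable [Finite I]

/-- The coproduct is `Δ(f)(M, N) = f(M ⊕ N)`, the counit is evaluation at the zero representation. -/
noncomputable instance : CoalgebraStruct ℂ (HallAlgebra I) where
  comul :=
    { toFun := fun f => tensorEquiv.symm <| Finsupp.ofSupportFinite (fun p => f (p.1 + p.2)) <| by
        refine (f.finite_support.biUnion fun c _ => IsoClass.finite_add_eq c).subset fun p hp => ?_
        exact Set.mem_biUnion (x := p.1 + p.2) hp rfl
      map_add' := fun f g => by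
        rw [← map_add]; exact congrArg _ (Finsupp.ext fun _ => rfl)
      map_smul' := fun a f => by
        rw [← map_smul]; exact congrArg _ (Finsupp.ext fun _ => rfl) }
  counit := { toFun := fun f => f 0, map_add' := fun _ _ => rfl, map_smul' := fun _ _ => rfl }

theorem comul_apply (f : HallAlgebra I) (a b : IsoClass I) :
    tensorEquiv (CoalgebraStruct.comul (R := ℂ) f) (a, b) = f (a + b) := by
  change tensorEquiv (tensorEquiv.symm _) (a, b) = _
  rw [LinearEquiv.apply_symm_apply]; rfl

theorem counit_apply (f : HallAlgebra I) : CoalgebraStruct.counit (R := ℂ) f = f 0 := rfl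

theorem ev₃_lTensor (x : HallAlgebra I ⊗[ℂ] HallAlgebra I) (a b c : IsoClass I) :
    tensorEquiv₃ ((CoalgebraStruct.comul (R := ℂ)).lTensor (HallAlgebra I) x) (a, b, c)
      = tensorEquiv x (a, b + c) := by
  induction x with
  | zero => simp
  | tmul f g =>
    rw [LinearMap.lTensor_tmul, tensorEquiv₃_tmul, tensorEquiv_tmul, comul_apply]
  | add x y hx hy => simp only [map_add, Finsupp.add_apply, hx, hy]

theorem ev₃_rTensor (x : HallAlgebra I ⊗[ℂ] HallAlgebra I) (a b c : IsoClass I) :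
    tensorEquiv₃ (TensorProduct.assoc ℂ _ _ _
      ((CoalgebraStruct.comul (R := ℂ)).rTensor (HallAlgebra I) x)) (a, b, c)
      = tensorEquiv x (a + b, c) := by
  induction x with
  | zero => simp
  | tmul f g =>
    rw [LinearMap.rTensor_tmul, ev₃_assoc_tmul, tensorEquiv_tmul, comul_apply]
  | add x y hx hy => simp only [map_add, Finsupp.add_apply, hx, hy]

noncomputable instance : Coalgebra ℂ (HallAlgebra I) where
  coassoc := by
    refine LinearMap.ext fun f => tensorEquiv₃.injective (Finsupp.ext fun ⟨a, b, c⟩ => ?_)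
    simp only [LinearMap.comp_apply, LinearEquiv.coe_coe]
    rw [ev₃_rTensor, ev₃_lTensor, comul_apply, comul_apply, add_assoc]
  rTensor_counit_comp_comul := by
    have key : ∀ x : HallAlgebra I ⊗[ℂ] HallAlgebra I, ∀ c,
        TensorProduct.lid ℂ _ ((CoalgebraStruct.counit (R := ℂ)).rTensor (HallAlgebra I) x) c
          = tensorEquiv x (0, c) := fun x c => by
      induction x with
      | zero => simp [zero_apply]
      | tmul f g => rw [tensorEquiv_tmul]; rfl
      | add x y hx hy => simp only [map_add, Finsupp.add_apply, add_apply, hx, hy]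
    refine LinearMap.ext fun f => (TensorProduct.lid ℂ _).injective (ext fun M => ?_)
    simp only [LinearMap.comp_apply, key, comul_apply, zero_add]
    simp
  lTensor_counit_comp_comul := by
    have key : ∀ x : HallAlgebra I ⊗[ℂ] HallAlgebra I, ∀ c,
        TensorProduct.rid ℂ _ ((CoalgebraStruct.counit (R := ℂ)).lTensor (HallAlgebra I) x) c
          = tensorEquiv x (c, 0) := fun x c => by
      induction x with
      | zero => simp [zero_apply]
      | tmul f g => rw [tensorEquiv_tmul, mul_comm]; rfl
      | add x y hx hy => simp only [map_add, Finsupp.add_apply, add_apply, hx, hy]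
    refine LinearMap.ext fun f => (TensorProduct.rid ℂ _).injective (ext fun M => ?_)
    simp only [LinearMap.comp_apply, key, comul_apply, add_zero]
    simp

end Finite

end HallAlgebra

namespace F1Rep.Sub

variable {I : Type u} [Quiver.{v} I]

theorem mem_image_proj {M : F1Rep I} {L L' : Sub M} (h : ∀ i, L.carrier i ⊆ L'.carrier i) (i : I)
    (x : M.V i) : L.proj.app i x ∈ (image L.proj L').carrier i ↔ x ∈ L'.carrier i := by
  constructor
  · rintro ⟨y, hy, e⟩
    rcases Quotient.exact e with rfl | ⟨_, hx⟩
    · exact hy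
    · exact h i hx
  · intro hx
    exact ⟨x, hx, rfl⟩

/-- Subrepresentations of a quotient. -/
def quotEquiv {M : F1Rep I} (L : Sub M) :
    Sub L.quot ≃ {L' : Sub M // ∀ i, L.carrier i ⊆ L'.carrier i} where
  toFun K := ⟨comap L.proj K, fun i x hx => by
    change L.proj.app i x ∈ K.carrier i
    rw [(L.proj_eq_zero i x).2 hx]; exact K.zero_mem i⟩
  invFun L' := image L.proj L'.1
  left_inv K := by
    ext i x
    obtain ⟨x, rfl⟩ := L.proj_surjective i x
    constructor
    · rintro ⟨y, hy, e⟩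
      rw [← e]; exact hy
    · intro hx
      exact ⟨x, hx, rfl⟩
  right_inv L' := by
    refine Subtype.ext (Sub.ext (funext fun i => Set.ext fun x => ?_))
    exact mem_image_proj L'.2 i x

/-- Subrepresentations of a subrepresentation. -/
def subEquiv {M : F1Rep I} (L' : Sub M) :
    Sub L'.toRep ≃ {L : Sub M // ∀ i, L.carrier i ⊆ L'.carrier i} where
  toFun K := ⟨image L'.incl K, by
    rintro i _ ⟨x, -, rfl⟩
    exact x.2⟩
  invFun L := comap L'.incl L.1
  left_inv K := by
    ext i x
    constructor
    · rintro ⟨y, hy, e⟩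
      rwa [← show y = x from Subtype.ext e]
    · intro hx
      exact ⟨x, hx, rfl⟩
  right_inv L := by
    refine Subtype.ext (Sub.ext (funext fun i => Set.ext fun x => ⟨?_, fun hx => ?_⟩))
    · rintro ⟨y, hy, rfl⟩
      exact hy
    · exact ⟨⟨x, L.2 i hx⟩, hx, rfl⟩

theorem toRep_image_iso {M : F1Rep I} (L' : Sub M) (K : Sub L'.toRep) :
    Nonempty (K.toRep ≅ (image L'.incl K).toRep) := by
  let j : K.toRep ⟶ M := (show K.toRep ⟶ L'.toRep from K.incl) ≫ (show L'.toRep ⟶ M from L'.incl)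
  refine toRep_iso _ j (fun i => Subtype.val_injective.comp Subtype.val_injective) fun i => ?_
  ext x
  constructor
  · rintro ⟨y, rfl⟩
    exact ⟨y.1, y.2, rfl⟩
  · rintro ⟨y, hy, rfl⟩
    exact ⟨⟨y, hy⟩, rfl⟩

/-- The subquotient `L'/L` computed in `L'` and in `M/L`. -/
theorem subquot_iso {M : F1Rep I} (L : Sub M) (K : Sub L.quot) :
    Nonempty ((comap (comap L.proj K).incl L).quot ≅ K.toRep) := by
  refine quot_iso _
    { app := fun i =>
        { toFun := fun x => ⟨L.proj.app i x.1, x.2⟩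
          map_zero := rfl
          inj := fun x y h0 e => Subtype.ext ((L.proj.app i).inj x.1 y.1
            (fun h => h0 (Subtype.ext h)) (congrArg Subtype.val e)) }
      comm := fun _ _ => rfl } ?_ ?_
  · rintro i ⟨y, hy⟩
    obtain ⟨x, rfl⟩ := L.proj_surjective i y
    exact ⟨⟨x, hy⟩, rfl⟩
  · intro i x
    refine Iff.trans ?_ (L.proj_eq_zero i x.1)
    exact ⟨fun h => congrArg Subtype.val h, fun h => Subtype.ext h⟩

/-- The direct sum of two subrepresentations. -/
def prod {A B : F1Rep I} (F : Sub A) (G : Sub B) : Sub (A.directSum B) where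
  carrier i := {p | p.1.1 ∈ F.carrier i ∧ p.1.2 ∈ G.carrier i}
  zero_mem i := ⟨F.zero_mem i, G.zero_mem i⟩
  map_mem h := fun hp => ⟨F.map_mem h hp.1, G.map_mem h hp.2⟩

/-- The subrepresentations of a direct sum are the direct sums of subrepresentations. -/
def prodEquiv (A B : F1Rep I) : Sub A × Sub B ≃ Sub (A.directSum B) where
  toFun p := prod p.1 p.2
  invFun X :=
    (⟨fun i => {x | (⟨(x, 0), Or.inr rfl⟩ : F1Sum (A.V i) (B.V i)) ∈ X.carrier i},
      fun i => X.zero_mem i, fun {i j} h {x} hx => by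
        have := X.map_mem h hx
        rwa [show (A.directSum B).map h (⟨(x, 0), Or.inr rfl⟩ : F1Sum (A.V i) (B.V i)) =
          (⟨(A.map h x, 0), Or.inr rfl⟩ : F1Sum (A.V j) (B.V j)) from
          Subtype.ext (Prod.ext rfl (B.map h).map_zero)] at this⟩,
     ⟨fun i => {x | (⟨(0, x), Or.inl rfl⟩ : F1Sum (A.V i) (B.V i)) ∈ X.carrier i},
      fun i => X.zero_mem i, fun {i j} h {x} hx => by
        have := X.map_mem h hx
        rwa [show (A.directSum B).map h (⟨(0, x), Or.inl rfl⟩ : F1Sum (A.V i) (B.V i)) =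
          (⟨(0, B.map h x), Or.inl rfl⟩ : F1Sum (A.V j) (B.V j)) from
          Subtype.ext (Prod.ext (A.map h).map_zero rfl)] at this⟩)
  left_inv p := by
    refine Prod.ext (Sub.ext (funext fun i => Set.ext fun x => ?_))
      (Sub.ext (funext fun i => Set.ext fun x => ?_))
    · exact ⟨fun h => h.1, fun h => ⟨h, p.2.zero_mem i⟩⟩
    · exact ⟨fun h => h.2, fun h => ⟨p.1.zero_mem i, h⟩⟩
  right_inv X := by
    refine Sub.ext (funext fun i => Set.ext ?_)
    rintro ⟨⟨x, y⟩, h⟩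
    rcases h with h | h
    · obtain rfl : x = 0 := h
      exact ⟨fun h => h.2, fun h => ⟨X.zero_mem i, h⟩⟩
    · obtain rfl : y = 0 := h
      exact ⟨fun h => h.1, fun h => ⟨h, X.zero_mem i⟩⟩

theorem prod_toRep_iso {A B : F1Rep I} (F : Sub A) (G : Sub B) :
    Nonempty (F.toRep.directSum G.toRep ≅ (prod F G).toRep) := by
  refine toRep_iso _
    { app := fun i =>
        { toFun := fun p => ⟨(p.1.1.1, p.1.2.1), p.2.imp (congrArg Subtype.val) (congrArg Subtype.val)⟩
          map_zero := rfl
          inj := fun p q _ h => Subtype.ext (Prod.ext (Subtype.ext (congrArg (fun p => p.1.1) h))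
            (Subtype.ext (congrArg (fun p => p.1.2) h))) }
      comm := fun _ _ => rfl } ?_ ?_
  · intro i p q h
    exact Subtype.ext (Prod.ext (Subtype.ext (congrArg (fun p => p.1.1) h))
      (Subtype.ext (congrArg (fun p => p.1.2) h)))
  · intro i
    ext p
    constructor
    · rintro ⟨q, rfl⟩
      exact ⟨q.1.1.2, q.1.2.2⟩
    · intro hp
      exact ⟨⟨(⟨p.1.1, hp.1⟩, ⟨p.1.2, hp.2⟩), p.2.imp (fun h => Subtype.ext h)
        (fun h => Subtype.ext h)⟩, rfl⟩

theorem prod_quot_iso {A B : F1Rep I} (F : Sub A) (G : Sub B) :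
    Nonempty ((prod F G).quot ≅ F.quot.directSum G.quot) := by
  refine quot_iso _
    { app := fun i =>
        { toFun := fun p => ⟨(F.proj.app i p.1.1, G.proj.app i p.1.2), p.2.imp
            (fun h => by rw [h]; rfl) (fun h => by rw [h]; rfl)⟩
          map_zero := rfl
          inj := ?_ }
      comm := fun _ _ => rfl } ?_ ?_
  · rintro ⟨⟨x, y⟩, hp⟩ ⟨⟨x', y'⟩, hq⟩ h0 e
    have e1 : F.proj.app i x = F.proj.app i x' := congrArg (fun p => p.1.1) e
    have e2 : G.proj.app i y = G.proj.app i y' := congrArg (fun p => p.1.2) e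
    have h0' : ¬ (F.proj.app i x = 0 ∧ G.proj.app i y = 0) := fun hh =>
      h0 (Subtype.ext (Prod.ext hh.1 hh.2))
    have mz := (F.proj.app i).map_zero
    have nz := (G.proj.app i).map_zero
    have mi := (F.proj.app i).inj x x'
    have ni := (G.proj.app i).inj y y'
    refine Subtype.ext (Prod.ext ?_ ?_) <;> grind
  · rintro i ⟨⟨x, y⟩, h | h⟩
    · obtain rfl : x = 0 := h
      obtain ⟨y, rfl⟩ := G.proj_surjective i y
      exact ⟨⟨(0, y), Or.inl rfl⟩, rfl⟩
    · obtain rfl : y = 0 := h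
      obtain ⟨x, rfl⟩ := F.proj_surjective i x
      exact ⟨⟨(x, 0), Or.inr rfl⟩, rfl⟩
  · intro i p
    change _ ↔ p.1.1 ∈ F.carrier i ∧ p.1.2 ∈ G.carrier i
    rw [← F.proj_eq_zero, ← G.proj_eq_zero]
    exact ⟨fun h => ⟨congrArg (fun p => p.1.1) h, congrArg (fun p => p.1.2) h⟩,
      fun h => Subtype.ext (Prod.ext h.1 h.2)⟩

/-- The zero subrepresentation. -/
def bot (M : F1Rep I) : Sub M where
  carrier _ := {0}
  zero_mem _ := rfl
  map_mem {i j} h {x} hx := by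
    obtain rfl : x = 0 := hx
    exact (M.map h).map_zero

/-- The full subrepresentation. -/
def top (M : F1Rep I) : Sub M := ⟨fun _ => Set.univ, fun _ => trivial, fun _ _ _ => trivial⟩

theorem quot_bot_iso (M : F1Rep I) : Nonempty ((bot M).quot ≅ M) :=
  quot_iso _ (𝟙 M : M ⟶ M) (fun _ => Function.surjective_id) fun _ _ => Iff.rfl

theorem toRep_top_iso (M : F1Rep I) : Nonempty (M ≅ (top M).toRep) :=
  toRep_iso _ (𝟙 M : M ⟶ M) (fun _ => Function.injective_id) fun _ => Set.range_id

end F1Rep.Sub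

namespace IsoClass

variable {I : Type u} [Quiver.{v} I]

theorem mk_eq_zero {M : F1Rep I} : mk M = 0 ↔ ∀ i, ∀ x : M.V i, x = 0 := by
  constructor
  · intro h i x
    obtain ⟨e⟩ := mk_eq.1 (show mk M = mk (zeroRep I) from h)
    exact (bijective_of_iso e i).1 rfl
  · intro h
    refine mk_eq.2 (isIsomorphic_of_bijective (M := M) (N := zeroRep I)
      { app := fun i => ⟨fun _ => (), rfl, fun x y _ _ => (h i x).trans (h i y).symm⟩
        comm := fun _ _ => rfl } fun i => ⟨fun x y _ => (h i x).trans (h i y).symm, fun _ => ⟨0, rfl⟩⟩)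

theorem mk_toRep_eq_zero {M : F1Rep I} {L : Sub M} : mk L.toRep = 0 ↔ L = Sub.bot M := by
  rw [mk_eq_zero]
  constructor
  · intro h
    ext i x
    refine ⟨fun hx => congrArg Subtype.val (h i ⟨x, hx⟩), fun hx => ?_⟩
    obtain rfl : x = 0 := hx
    exact L.zero_mem i
  · rintro rfl i x
    exact Subtype.ext x.2

theorem mk_quot_eq_zero {M : F1Rep I} {L : Sub M} : mk L.quot = 0 ↔ L = Sub.top M := by
  rw [mk_eq_zero]
  constructor
  · intro h
    ext i x
    exact ⟨fun _ => trivial, fun _ => (L.proj_eq_zero i x).1 (h i _)⟩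
  · rintro rfl i x
    obtain ⟨x, rfl⟩ := Sub.proj_surjective _ i x
    exact (Sub.proj_eq_zero _ i x).2 trivial

theorem add_eq_zero {a b : IsoClass I} : a + b = 0 ↔ a = 0 ∧ b = 0 := by
  induction a using ind with | _ A
  induction b using ind with | _ B
  rw [mk_add, mk_eq_zero, mk_eq_zero, mk_eq_zero]
  constructor
  · intro h
    exact ⟨fun i x => congrArg (fun p => p.1.1) (h i ⟨(x, 0), Or.inr rfl⟩),
      fun i x => congrArg (fun p => p.1.2) (h i ⟨(0, x), Or.inl rfl⟩)⟩
  · rintro ⟨hA, hB⟩ i p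
    exact Subtype.ext (Prod.ext (hA i _) (hB i _))

end IsoClass

namespace HallAlgebra

variable {I : Type u} [Quiver.{v} I]

open Classical in
theorem delta_apply (c d : IsoClass I) : delta c d = if d = c then 1 else 0 := by
  change Finsupp.single c (1 : ℂ) d = _
  rw [Finsupp.single_apply]
  simp only [eq_comm]

open Classical in
theorem sum_equiv_subtype {α β : Type*} [Fintype α] [Fintype β] {p : β → Prop}
    (e : α ≃ {b // p b}) (F : β → ℂ) : ∑ a, F (e a).1 = ∑ b, if p b then F b else 0 := by
  rw [e.sum_comp (fun b => F b.1), ← Finset.sum_filter, ← Finset.sum_subtype_eq_sum_filter]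
  exact Finset.sum_congr (by ext; simp) fun _ _ => rfl

/-- The unit is the class of the zero representation. -/
noncomputable instance : One (HallAlgebra I) := ⟨delta 0⟩

theorem one_def : (1 : HallAlgebra I) = delta 0 := rfl

section Finite

variable [Finite I] [∀ i j : I, Finite (i ⟶ j)]

/-- The convolution product `(f g)(M) = ∑_{L ⊆ M} f(M/L) g(L)`. -/
noncomputable instance : Mul (HallAlgebra I) where
  mul f g := toFinsupp.symm <| Finsupp.ofSupportFinite (conv f g) <| by
    refine (IsoClass.finite_extensions f.finite_support g.finite_support).subset fun c => ?_
    induction c using IsoClass.ind with | _ M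
    intro h
    by_contra hc
    refine h (finsum_eq_zero_of_forall_eq_zero fun L => ?_)
    by_contra hL
    exact hc ⟨M, L, rfl, left_ne_zero_of_mul hL, right_ne_zero_of_mul hL⟩

theorem mul_apply (f g : HallAlgebra I) (M : F1Rep I) : (f * g) (IsoClass.mk M) =
    ∑ᶠ L : Sub M, f (IsoClass.mk L.quot) * g (IsoClass.mk L.toRep) := rfl

theorem mul_apply' (f g : HallAlgebra I) (M : F1Rep I) [Fintype (Sub M)] : (f * g) (IsoClass.mk M) =
    ∑ L : Sub M, f (IsoClass.mk L.quot) * g (IsoClass.mk L.toRep) := by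
  rw [mul_apply, finsum_eq_sum_of_fintype]

protected theorem mul_assoc' (f g h : HallAlgebra I) : f * g * h = f * (g * h) := by
  classical
  refine ext fun M => ?_
  let : ∀ N : F1Rep I, Fintype (Sub N) := fun N => Fintype.ofFinite _
  let T : Sub M → Sub M → ℂ := fun L L' => f (IsoClass.mk L'.quot) *
    g (IsoClass.mk (Sub.comap L'.incl L).quot) * h (IsoClass.mk L.toRep)
  have h1 : ∀ L : Sub M, (f * g) (IsoClass.mk L.quot) * h (IsoClass.mk L.toRep) =
      ∑ L', if ∀ i, L.carrier i ⊆ L'.carrier i then T L L' else 0 := fun L => by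
    rw [mul_apply', Finset.sum_mul, ← sum_equiv_subtype L.quotEquiv (T L)]
    refine Finset.sum_congr rfl fun K _ => ?_
    have e1 := IsoClass.mk_eq.2 (Sub.quot_comap_iso L.proj L.proj_surjective K)
    have e2 := IsoClass.mk_eq.2 (Sub.subquot_iso L K)
    rw [← e1, ← e2]; rfl
  have h2 : ∀ L' : Sub M, f (IsoClass.mk L'.quot) * (g * h) (IsoClass.mk L'.toRep) =
      ∑ L, if ∀ i, L.carrier i ⊆ L'.carrier i then T L L' else 0 := fun L' => by
    rw [mul_apply', Finset.mul_sum, ← sum_equiv_subtype L'.subEquiv (fun L => T L L')]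
    refine Finset.sum_congr rfl fun K _ => ?_
    have e1 := IsoClass.mk_eq.2 (Sub.toRep_image_iso L' K)
    have e2 : Sub.comap L'.incl (Sub.image L'.incl K) = K := L'.subEquiv.symm_apply_apply K
    rw [e1, ← mul_assoc]
    change _ = _ * g (IsoClass.mk (Sub.comap L'.incl (Sub.image L'.incl K)).quot) * _
    rw [e2]; rfl
  rw [mul_apply', mul_apply', Finset.sum_congr rfl fun L _ => h1 L,
    Finset.sum_congr rfl fun L _ => h2 L, Finset.sum_comm]

protected theorem one_mul' (f : HallAlgebra I) : 1 * f = f := by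
  classical
  refine ext fun M => ?_
  let : Fintype (Sub M) := Fintype.ofFinite _
  rw [mul_apply', Finset.sum_eq_single (Sub.top M)]
  · rw [one_def, delta_apply, if_pos (IsoClass.mk_quot_eq_zero.2 rfl), one_mul,
      ← IsoClass.mk_eq.2 (Sub.toRep_top_iso M)]
  · intro L _ hL
    rw [one_def, delta_apply, if_neg (fun h => hL (IsoClass.mk_quot_eq_zero.1 h)), zero_mul]
  · simp

protected theorem mul_one' (f : HallAlgebra I) : f * 1 = f := by
  classical
  refine ext fun M => ?_
  let : Fintype (Sub M) := Fintype.ofFinite _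
  rw [mul_apply', Finset.sum_eq_single (Sub.bot M)]
  · rw [one_def, delta_apply, if_pos (IsoClass.mk_toRep_eq_zero.2 rfl), mul_one,
      IsoClass.mk_eq.2 (Sub.quot_bot_iso M)]
  · intro L _ hL
    rw [one_def, delta_apply, if_neg (fun h => hL (IsoClass.mk_toRep_eq_zero.1 h)), mul_zero]
  · simp

noncomputable instance : Ring (HallAlgebra I) where
  __ := (inferInstance : AddCommGroup (HallAlgebra I))
  mul_assoc := HallAlgebra.mul_assoc'
  one_mul := HallAlgebra.one_mul'
  mul_one := HallAlgebra.mul_one'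
  left_distrib f g h := by
    refine ext fun M => ?_
    let : Fintype (Sub M) := Fintype.ofFinite _
    simp only [mul_apply', add_apply, mul_add, Finset.sum_add_distrib]
  right_distrib f g h := by
    refine ext fun M => ?_
    let : Fintype (Sub M) := Fintype.ofFinite _
    simp only [mul_apply', add_apply, add_mul, Finset.sum_add_distrib]
  zero_mul f := by
    refine ext fun M => ?_
    let : Fintype (Sub M) := Fintype.ofFinite _
    simp only [mul_apply', zero_apply, zero_mul, Finset.sum_const_zero]
  mul_zero f := by
    refine ext fun M => ?_
    let : Fintype (Sub M) := Fintype.ofFinite _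
    simp only [mul_apply', zero_apply, mul_zero, Finset.sum_const_zero]

noncomputable instance : Algebra ℂ (HallAlgebra I) :=
  Algebra.ofModule
    (fun a f g => by
      refine ext fun M => ?_
      let : Fintype (Sub M) := Fintype.ofFinite _
      simp only [mul_apply', smul_apply, Finset.mul_sum, mul_assoc])
    (fun a f g => by
      refine ext fun M => ?_
      let : Fintype (Sub M) := Fintype.ofFinite _
      simp only [mul_apply', smul_apply, Finset.mul_sum, mul_left_comm])

theorem tensor_mul_apply (x y : HallAlgebra I ⊗[ℂ] HallAlgebra I) (A B : F1Rep I)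
    [Fintype (Sub A)] [Fintype (Sub B)] :
    tensorEquiv (x * y) (IsoClass.mk A, IsoClass.mk B) = ∑ p : Sub A × Sub B,
      tensorEquiv x (IsoClass.mk p.1.quot, IsoClass.mk p.2.quot) *
        tensorEquiv y (IsoClass.mk p.1.toRep, IsoClass.mk p.2.toRep) := by
  induction x with
  | zero => simp
  | add x x' hx hx' =>
    simp only [add_mul, map_add, Finsupp.add_apply, hx, hx', Finset.sum_add_distrib]
  | tmul f g =>
    induction y with
    | zero => simp
    | add y y' hy hy' =>
      simp only [mul_add, map_add, Finsupp.add_apply, hy, hy', Finset.sum_add_distrib]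
    | tmul f' g' =>
      simp only [Algebra.TensorProduct.tmul_mul_tmul, tensorEquiv_tmul, mul_apply']
      rw [Finset.sum_mul_sum, ← Finset.univ_product_univ, Finset.sum_product]
      exact Finset.sum_congr rfl fun F _ => Finset.sum_congr rfl fun G _ => by ring

noncomputable instance : Bialgebra ℂ (HallAlgebra I) :=
  Bialgebra.mk' ℂ (HallAlgebra I)
    (by
      classical
      change (1 : HallAlgebra I) 0 = 1
      rw [one_def, delta_apply, if_pos rfl])
    (fun {f g} => by
      classical
      let : Fintype (Sub (zeroRep I)) := Fintype.ofFinite _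
      have h : ∀ L : Sub (zeroRep I), L = Sub.bot _ := fun L => by
        ext i x
        exact ⟨fun _ => rfl, fun _ => L.zero_mem i⟩
      change (f * g) (IsoClass.mk (zeroRep I)) = f 0 * g 0
      rw [mul_apply', Finset.sum_eq_single (Sub.bot (zeroRep I)) (fun L _ hL => (hL (h L)).elim)
        (by simp), IsoClass.mk_toRep_eq_zero.2 rfl, IsoClass.mk_quot_eq_zero.2 (h _).symm])
    (by
      classical
      refine tensor_ext fun a b => ?_
      rw [Algebra.TensorProduct.one_def, tensorEquiv_tmul, comul_apply, one_def, delta_apply,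
        delta_apply, delta_apply]
      simp only [IsoClass.add_eq_zero]
      by_cases ha : a = 0 <;> by_cases hb : b = 0 <;> simp [ha, hb])
    (fun {f g} => by
      refine tensor_ext fun a b => ?_
      induction a using IsoClass.ind with | _ A
      induction b using IsoClass.ind with | _ B
      let : ∀ N : F1Rep I, Fintype (Sub N) := fun N => Fintype.ofFinite _
      rw [comul_apply, tensor_mul_apply, IsoClass.mk_add, mul_apply',
        ← (Sub.prodEquiv A B).sum_comp]
      refine Finset.sum_congr rfl fun p _ => ?_
      have e1 := IsoClass.mk_eq.2 (Sub.prod_quot_iso p.1 p.2)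
      have e2 := IsoClass.mk_eq.2 (Sub.prod_toRep_iso p.1 p.2)
      rw [comul_apply, comul_apply, IsoClass.mk_add, IsoClass.mk_add, ← e1, e2]
      rfl)

end Finite

end HallAlgebra

/-! ### Hopf-algebraic notions -/

section Enveloping

attribute [local instance 2000] LieRing.ofAssociativeRing

namespace UniversalEnvelopingAlgebra

variable (R L : Type*) [CommRing R] [LieRing L] [LieAlgebra R L]

/-- The coproduct of the enveloping algebra, the algebra homomorphism with `x ↦ x ⊗ 1 + 1 ⊗ x` for
all `x` in the Lie algebra. -/
noncomputable def comulHom : UniversalEnvelopingAlgebra R L →ₐ[R]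
    UniversalEnvelopingAlgebra R L ⊗[R] UniversalEnvelopingAlgebra R L :=
  lift R
    { toFun := fun x => ι R x ⊗ₜ[R] 1 + 1 ⊗ₜ[R] ι R x
      map_add' := fun x y => by
        rw [map_add, TensorProduct.add_tmul, TensorProduct.tmul_add]; abel
      map_smul' := fun a x => by
        rw [map_smul, ← TensorProduct.smul_tmul', TensorProduct.tmul_smul, smul_add]; rfl
      map_lie' := fun {x y} => by
        rw [LieHom.map_lie]
        simp only [LieRing.of_associative_ring_bracket, TensorProduct.sub_tmul,
          TensorProduct.tmul_sub, add_mul, mul_add, Algebra.TensorProduct.tmul_mul_tmul, one_mul,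
          mul_one]
        abel }

/-- The counit of the enveloping algebra, the algebra homomorphism that kills the Lie algebra. -/
noncomputable def counitHom : UniversalEnvelopingAlgebra R L →ₐ[R] R :=
  lift R (0 : L →ₗ⁅R⁆ R)

theorem comulHom_ι (x : L) : comulHom R L (ι R x) = ι R x ⊗ₜ[R] 1 + 1 ⊗ₜ[R] ι R x :=
  lift_ι_apply R _ x

theorem counitHom_ι (x : L) : counitHom R L (ι R x) = 0 := lift_ι_apply R _ x

/-- The standard bialgebra structure of the enveloping algebra. -/
noncomputable instance : Bialgebra R (UniversalEnvelopingAlgebra R L) :=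
  Bialgebra.ofAlgHom (comulHom R L) (counitHom R L)
    (by
      refine hom_ext R (LieHom.ext fun x => ?_)
      change Algebra.TensorProduct.assoc R R R _ _ _
        (Algebra.TensorProduct.map (comulHom R L) (.id R _) (comulHom R L (ι R x))) =
        Algebra.TensorProduct.map (.id R _) (comulHom R L) (comulHom R L (ι R x))
      simp only [comulHom_ι, map_add, Algebra.TensorProduct.map_tmul, AlgHom.id_apply, map_one,
        TensorProduct.add_tmul, TensorProduct.tmul_add, Algebra.TensorProduct.assoc_tmul,
        Algebra.TensorProduct.one_def, add_assoc])
    (by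
      refine hom_ext R (LieHom.ext fun x => ?_)
      change Algebra.TensorProduct.map (counitHom R L) (.id R _) (comulHom R L (ι R x)) =
        (Algebra.TensorProduct.lid R _).symm (ι R x)
      rw [comulHom_ι, map_add, Algebra.TensorProduct.map_tmul, Algebra.TensorProduct.map_tmul,
        counitHom_ι, map_one, TensorProduct.zero_tmul, zero_add,
        map_one (counitHom R L)]
      rfl)
    (by
      refine hom_ext R (LieHom.ext fun x => ?_)
      change Algebra.TensorProduct.map (.id R _) (counitHom R L) (comulHom R L (ι R x)) =
        (Algebra.TensorProduct.rid R R _).symm (ι R x)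
      rw [comulHom_ι, map_add, Algebra.TensorProduct.map_tmul, Algebra.TensorProduct.map_tmul,
        counitHom_ι, map_one, TensorProduct.tmul_zero, add_zero]
      rfl)

end UniversalEnvelopingAlgebra

end Enveloping

attribute [local instance 100] LieRing.ofAssociativeRing

/-- The Lie algebra of primitive elements of a bialgebra, with the commutator bracket. -/
noncomputable def primitiveElements (R A : Type*) [CommRing R] [Ring A] [Bialgebra R A] :
    LieSubalgebra R A where
  carrier := {x | CoalgebraStruct.comul (R := R) x = x ⊗ₜ[R] 1 + 1 ⊗ₜ[R] x}
  zero_mem' := by simp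
  add_mem' {x y} hx hy := by
    simp only [Set.mem_ofPred_eq] at *
    rw [map_add, hx, hy, TensorProduct.add_tmul, TensorProduct.tmul_add]; abel
  smul_mem' a x hx := by
    simp only [Set.mem_ofPred_eq] at *
    rw [map_smul, hx, ← TensorProduct.smul_tmul', TensorProduct.tmul_smul, smul_add]
  lie_mem' {x y} hx hy := by
    change CoalgebraStruct.comul (R := R) x = _ at hx
    change CoalgebraStruct.comul (R := R) y = _ at hy
    change CoalgebraStruct.comul (R := R) ⁅x, y⁆ = _
    rw [LieRing.of_associative_ring_bracket, map_sub, Bialgebra.comul_mul, Bialgebra.comul_mul, hx, hy]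
    simp only [TensorProduct.sub_tmul, TensorProduct.tmul_sub, add_mul, mul_add,
      Algebra.TensorProduct.tmul_mul_tmul, one_mul, mul_one]
    abel

/-- `S` is an antipode for the bialgebra `A`; a bialgebra with an antipode is a Hopf algebra. -/
structure IsAntipode (R : Type*) {A : Type*} [CommRing R] [Ring A] [Bialgebra R A] (S : A →ₗ[R] A) :
    Prop where
  left : LinearMap.mul' R A ∘ₗ S.rTensor A ∘ₗ CoalgebraStruct.comul =
    Algebra.linearMap R A ∘ₗ CoalgebraStruct.counit
  right : LinearMap.mul' R A ∘ₗ S.lTensor A ∘ₗ CoalgebraStruct.comul =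
    Algebra.linearMap R A ∘ₗ CoalgebraStruct.counit

open Classical in
/-- The subspaces `𝒜 γ` form a grading of `A` for which the product, unit, coproduct, counit and
antipode `S` are homogeneous of degree zero, and the part of degree zero is spanned by `1`. -/
structure IsConnectedHopfGrading {R A Γ : Type*} [CommRing R] [Ring A] [Bialgebra R A]
    [AddCommMonoid Γ] (S : A →ₗ[R] A) (𝒜 : Γ → Submodule R A) : Prop where
  isInternal : DirectSum.IsInternal 𝒜
  one_mem : 1 ∈ 𝒜 0
  mul_mem : ∀ α β : Γ, ∀ x ∈ 𝒜 α, ∀ y ∈ 𝒜 β, x * y ∈ 𝒜 (α + β)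
  comul_mem : ∀ γ : Γ, ∀ x ∈ 𝒜 γ, CoalgebraStruct.comul (R := R) x ∈
    ⨆ p : {p : Γ × Γ // p.1 + p.2 = γ},
      LinearMap.range (TensorProduct.map (𝒜 p.1.1).subtype (𝒜 p.1.2).subtype)
  counit_eq_zero : ∀ γ : Γ, γ ≠ 0 → ∀ x ∈ 𝒜 γ, CoalgebraStruct.counit (R := R) x = 0
  antipode_mem : ∀ γ : Γ, ∀ x ∈ 𝒜 γ, S x ∈ 𝒜 γ
  connected : 𝒜 0 = Submodule.span R {1}

/-- A Lie algebra is pro-nilpotent (in the sense used for infinite direct sums of graded pieces) if it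
has a decreasing sequence of ideals with zero intersection and finite-dimensional nilpotent
quotients. -/
def IsProNilpotent (L : Type*) [LieRing L] [LieAlgebra ℂ L] : Prop :=
  ∃ F : ℕ → LieIdeal ℂ L, Antitone F ∧ (⨅ k, F k) = ⊥ ∧
    ∀ k, FiniteDimensional ℂ (L ⧸ F k) ∧ LieRing.IsNilpotent (L ⧸ F k)

/-! ### Indecomposable representations and the gradings of the Hall algebra -/

namespace F1Rep

variable {I : Type u} [Quiver.{v} I]

/-- A representation is zero if all its pointed sets consist of the base point only. -/
def IsZeroRep (M : F1Rep I) : Prop := ∀ i, ∀ x : M.V i, x = 0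

/-- A non-zero representation is indecomposable if it is not a direct sum of two non-zero ones. -/
def Indecomposable (M : F1Rep I) : Prop :=
  ¬ M.IsZeroRep ∧ ∀ U W : F1Rep I, Nonempty (M ≅ U.directSum W) → U.IsZeroRep ∨ W.IsZeroRep

end F1Rep

/-- The Grothendieck group of the category of representations: the free abelian group on isomorphism
classes modulo `[M] = [L] + [M/L]` for all subrepresentations `L` of `M`. -/
def K0 (I : Type u) [Quiver.{v} I] : Type (max u v 1) :=
  FreeAbelianGroup (IsoClass I) ⧸ AddSubgroup.closure {x | ∃ (M : F1Rep I) (L : Sub M),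
    x = FreeAbelianGroup.of (IsoClass.mk M) -
      (FreeAbelianGroup.of (IsoClass.mk L.toRep) + FreeAbelianGroup.of (IsoClass.mk L.quot))}

namespace K0

variable (I : Type u) [Quiver.{v} I]

instance : AddCommGroup (K0 I) := inferInstanceAs (AddCommGroup (_ ⧸ AddSubgroup.closure _))

variable {I} in
/-- The class of a representation in the Grothendieck group. -/
def cls (c : IsoClass I) : K0 I := QuotientAddGroup.mk (FreeAbelianGroup.of c)

/-- The effective cone: the submonoid generated by the classes of representations. -/
def cone : AddSubmonoid (K0 I) := AddSubmonoid.closure (Set.range cls)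

variable {I} in
/-- The class of a representation as an element of the effective cone. -/
def coneCls (c : IsoClass I) : cone I := ⟨cls c, AddSubmonoid.subset_closure ⟨c, rfl⟩⟩

end K0

namespace HallAlgebra

variable {I : Type u} [Quiver.{v} I]

/-- The functions supported on the isomorphism classes of degree `γ`, for a degree function `deg`. -/
noncomputable def piece {Γ : Type*} (deg : IsoClass I → Γ) (γ : Γ) : Submodule ℂ (HallAlgebra I) :=
  Submodule.span ℂ {f | ∃ c : IsoClass I, deg c = γ ∧ f = delta c}

/-- The Lie algebra of primitive elements of the Hall algebra. -/
noncomputable abbrev nilLie (I : Type u) [Quiver.{v} I] [Finite I] [∀ i j : I, Finite (i ⟶ j)] :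
    LieSubalgebra ℂ (HallAlgebra I) := primitiveElements ℂ (HallAlgebra I)

end HallAlgebra

/-! ### Additivity of the dimension vector -/

namespace F1Rep

variable {I : Type u} [Quiver.{v} I]

/-! The product and coproduct are already known to form a bialgebra. In the basis of delta
functions, Δ[c] is the sum of [a] ⊗ [b] over all a + b = c, so cocommutativity is the commutativity
of ⊕.

Antipode and gradings. The total dimension `size` is additive and positive off zero, so a
convolution inverse of the identity can be computed by recursion on size. Every degree function that
is additive on short exact sequences and vanishes only at 0 yields a connected Hopf grading
(`isConnectedHopfGrading_piece`). Dimension vectors are such a function, and so are classes in K₀,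
because the dimension vector factors through K₀.

Primitive elements. Primitivity of f reads f(a + b) = f(a)1(b) + 1(a)f(b), which says exactly that f
is supported on indecomposables (`mem_nilLie_iff_support`). Such f vanish at 0, so a bracket with
one of them raises the smallest size in the support. The ideals of elements vanishing below size k
therefore give pro-nilpotency.

Enveloping algebra. The argument is triangularity with respect to the number of summands. A product
of k primitive elements vanishes on sums of more than k non-zero classes (`VanishesAbove.mul`). On a
sum of exactly k indecomposables, a product of k indecomposable delta functions is non-zero
precisely when the two multisets agree (`deltaProd_apply_ne_zero_iff`). Hence the monomials, one for
each multiset, are linearly independent, and the monomials span the Hall algebra. In U(𝔫),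
reordering a product costs only shorter products, so one monomial for each multiset spans
(`span_envProd_toList`). A spanning family with linearly independent image makes U(𝔫) → H injective.
Thus only the easy half of Poincaré–Birkhoff–Witt is needed, and uniqueness of decompositions into
indecomposables is not an input. -/

theorem dimVec_eq {M : F1Rep I} (L : Sub M) : M.dimVec = L.quot.dimVec + L.toRep.dimVec := by
  classical
  funext i
  let π : {x // x ∉ L.carrier i} → {q : L.quot.V i // q ≠ 0} := fun x =>
    ⟨L.proj.app i x.1, fun h => x.2 ((L.proj_eq_zero i x.1).1 h)⟩
  -- The projection is injective off `L` by the condition on 𝔽₁-morphisms, and a non-zero point of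
  -- the quotient has its representative outside `L`.
  have hπ : Function.Bijective π := by
    refine ⟨fun x y h => Subtype.ext ((L.proj.app i).inj x.1 y.1 (π x).2
      (congrArg Subtype.val h)), ?_⟩
    rintro ⟨q, hq⟩
    obtain ⟨x, rfl⟩ := L.proj_surjective i q
    exact ⟨⟨x, fun h => hq ((L.proj_eq_zero i x).2 h)⟩, rfl⟩
  have h1 : Nat.card {x // x ∉ L.carrier i} = Nat.card {q : L.quot.V i // q ≠ 0} :=
    Nat.card_congr (Equiv.ofBijective π hπ)
  have h2 : Nat.card {q : L.quot.V i // q ≠ 0} + 1 = Nat.card (L.quot.V i) := by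
    have h : Nat.card {q : L.quot.V i // q = 0} + Nat.card {q : L.quot.V i // q ≠ 0}
        = Nat.card (L.quot.V i) := by
      rw [← Nat.card_sum]; exact Nat.card_congr (Equiv.sumCompl _)
    rwa [Nat.card_unique, add_comm] at h
  have h3 : Nat.card {x // x ∈ L.carrier i} + Nat.card {x // x ∉ L.carrier i}
      = Nat.card (M.V i) := by
    rw [← Nat.card_sum]; exact Nat.card_congr (Equiv.sumCompl _)
  have h4 : Nat.card {x // x ∈ L.carrier i} = Nat.card (L.toRep.V i) := rfl
  have := M.card_eq i
  have := L.quot.card_eq i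
  have := L.toRep.card_eq i
  change M.dimVec i = L.quot.dimVec i + L.toRep.dimVec i
  omega

theorem dimVec_eq_zero_iff {M : F1Rep I} : M.dimVec = 0 ↔ ∀ i, ∀ x : M.V i, x = 0 := by
  constructor
  · intro h i x
    have h1 := M.card_eq i
    rw [h, Pi.zero_apply, zero_add, Nat.card_eq_one_iff_unique] at h1
    exact h1.1.elim x 0
  · intro h
    funext i
    have : Subsingleton (M.V i) := ⟨fun x y => (h i x).trans (h i y).symm⟩
    have h1 := M.card_eq i
    rw [Nat.card_unique] at h1
    simpa using h1

end F1Rep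

/-! ### Degree functions on isomorphism classes -/

namespace IsoClass

variable {I : Type u} [Quiver.{v} I]

/-- The direct sum is an extension of its first summand by its second. -/
theorem exists_sub_add (A B : F1Rep I) : ∃ L : Sub (A.directSum B),
    mk L.quot = mk A ∧ mk L.toRep = mk B := by
  -- The subrepresentation is 0 ⊕ B, with quotient A/0 ⊕ B/B.
  refine ⟨Sub.prod (Sub.bot A) (Sub.top B), ?_, ?_⟩
  · rw [mk_eq.2 (Sub.prod_quot_iso _ _), ← mk_add, mk_quot_eq_zero.2 rfl, add_zero,
      mk_eq.2 (Sub.quot_bot_iso A)]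
  · rw [← mk_eq.2 (Sub.prod_toRep_iso _ _), ← mk_add, mk_toRep_eq_zero.2 rfl, zero_add,
      ← mk_eq.2 (Sub.toRep_top_iso B)]

/-- A function on isomorphism classes that is additive on short exact sequences and vanishes
exactly on the zero representation. -/
structure IsConnectedDegree {Γ : Type*} [AddCommMonoid Γ] (deg : IsoClass I → Γ) : Prop where
  exact : ∀ (M : F1Rep I) (L : Sub M), deg (mk M) = deg (mk L.quot) + deg (mk L.toRep)
  eq_zero_iff : ∀ c, deg c = 0 ↔ c = 0

namespace IsConnectedDegree

variable {Γ : Type*} [AddCommMonoid Γ] {deg : IsoClass I → Γ}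

theorem map_add (h : IsConnectedDegree deg) (a b : IsoClass I) :
    deg (a + b) = deg a + deg b := by
  induction a using ind with | _ A
  induction b using ind with | _ B
  obtain ⟨L, h1, h2⟩ := exists_sub_add A B
  rw [mk_add, h.exact _ L, h1, h2]

end IsConnectedDegree

theorem dimVec_eq_zero_iff (c : IsoClass I) : c.dimVec = 0 ↔ c = 0 := by
  induction c using ind with | _ M
  rw [dimVec_mk, F1Rep.dimVec_eq_zero_iff, mk_eq_zero]

theorem isConnectedDegree_dimVec : IsConnectedDegree (dimVec (I := I)) :=
  ⟨fun _ L => dimVec_eq L, dimVec_eq_zero_iff⟩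

/-- The total dimension of a class. -/
noncomputable def size (c : IsoClass I) : ℕ := ∑ᶠ i, c.dimVec i

theorem isConnectedDegree_size [Finite I] : IsConnectedDegree (size (I := I)) where
  exact M L := by
    simp only [size, isConnectedDegree_dimVec.exact M L, Pi.add_apply]
    exact finsum_add_distrib (Set.toFinite _) (Set.toFinite _)
  eq_zero_iff c := by
    have := Fintype.ofFinite I
    rw [← dimVec_eq_zero_iff, size, finsum_eq_sum_of_fintype, Finset.sum_eq_zero_iff, funext_iff]
    simp

theorem size_add [Finite I] (a b : IsoClass I) : (a + b).size = a.size + b.size :=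
  isConnectedDegree_size.map_add a b

theorem size_pos [Finite I] {c : IsoClass I} (h : c ≠ 0) : 0 < c.size :=
  Nat.pos_of_ne_zero fun h0 => h ((isConnectedDegree_size.eq_zero_iff c).1 h0)

theorem size_eq [Finite I] {M : F1Rep I} (L : Sub M) :
    (mk M).size = (mk L.quot).size + (mk L.toRep).size :=
  isConnectedDegree_size.exact M L

/-- Each coordinate of the dimension vector is at most the total, so the constant vector `k` bounds
it. -/
theorem finite_size_le [Finite I] [∀ i j : I, Finite (i ⟶ j)] (k : ℕ) :
    {c : IsoClass I | c.size ≤ k}.Finite := by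
  refine (finite_dimVec_le (fun _ => k)).subset fun c hc i => le_trans ?_ hc
  exact single_le_finsum (f := c.dimVec) i (Set.toFinite _) fun _ => Nat.zero_le _

end IsoClass

/-! ### The degree in the effective cone of the Grothendieck group -/

namespace K0

variable {I : Type u} [Quiver.{v} I]

theorem cls_exact (M : F1Rep I) (L : Sub M) :
    cls (IsoClass.mk M) = cls (IsoClass.mk L.quot) + cls (IsoClass.mk L.toRep) := by
  rw [add_comm]
  refine (QuotientAddGroup.eq_iff_sub_mem).2 ?_
  exact AddSubgroup.subset_closure ⟨M, L, rfl⟩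

/-- The dimension vector as a homomorphism on the Grothendieck group. -/
noncomputable def dimHom : K0 I →+ (I → ℤ) :=
  QuotientAddGroup.lift _ (FreeAbelianGroup.lift fun c : IsoClass I => fun i => (c.dimVec i : ℤ)) <| by
    rw [AddSubgroup.closure_le]
    rintro _ ⟨M, L, rfl⟩
    change FreeAbelianGroup.lift _ _ = 0
    rw [map_sub, map_add, FreeAbelianGroup.lift_apply_of, FreeAbelianGroup.lift_apply_of,
      FreeAbelianGroup.lift_apply_of]
    funext i
    simp only [IsoClass.isConnectedDegree_dimVec.exact M L, Pi.add_apply, Pi.sub_apply, Pi.zero_apply]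
    push_cast
    ring

theorem dimHom_cls (c : IsoClass I) (i : I) : dimHom (cls c) i = c.dimVec i :=
  congrFun (FreeAbelianGroup.lift_apply_of (fun c : IsoClass I => fun i => (c.dimVec i : ℤ)) c) i

/-- A class that dies in K₀ has dimension vector zero, because `dimHom` recovers that vector;
nothing else about K₀ is needed. -/
theorem isConnectedDegree_coneCls : IsoClass.IsConnectedDegree (coneCls (I := I)) where
  exact M L := Subtype.ext (cls_exact M L)
  eq_zero_iff c := by
    constructor
    · intro h
      have h1 : cls c = 0 := congrArg Subtype.val h
      rw [← IsoClass.dimVec_eq_zero_iff]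
      funext i
      have := dimHom_cls c i
      rw [h1, map_zero, Pi.zero_apply] at this
      exact (Int.natCast_eq_zero.1 this.symm)
    · rintro rfl
      -- The exact sequence with all terms zero gives [0] = [0] + [0], and K₀ is a group.
      have h := cls_exact (zeroRep I) (Sub.bot (zeroRep I))
      rw [IsoClass.mk_toRep_eq_zero.2 rfl, IsoClass.mk_eq.2 (Sub.quot_bot_iso _)] at h
      exact Subtype.ext (left_eq_add.1 h)

end K0

namespace HallAlgebra

variable {I : Type u} [Quiver.{v} I]

/-! ### The basis of delta functions -/

/-- The delta functions form a basis. -/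
noncomputable def basis : Module.Basis (IsoClass I) ℂ (HallAlgebra I) := .ofRepr toFinsupp

theorem delta_self (c : IsoClass I) : delta c c = 1 := by
  rw [delta_apply, if_pos rfl]

theorem delta_of_ne {c d : IsoClass I} (h : d ≠ c) : delta c d = 0 := by
  rw [delta_apply, if_neg h]

theorem delta_ne_zero {c d : IsoClass I} : delta c d ≠ 0 ↔ d = c := by
  rw [delta_apply]; simp

/-- Reduces spanning statements to the basis vectors in the support of a function. -/
theorem mem_of_support {S : Submodule ℂ (HallAlgebra I)} {f : HallAlgebra I}
    (h : ∀ c, f c ≠ 0 → delta c ∈ S) : f ∈ S := by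
  rw [← basis.linearCombination_repr f]
  exact Submodule.sum_mem _ fun c hc => S.smul_mem _ (h c (Finsupp.mem_support_iff.1 hc))

theorem mem_piece {Γ : Type*} {deg : IsoClass I → Γ} {γ : Γ} {f : HallAlgebra I} :
    f ∈ piece deg γ ↔ ∀ c, f c ≠ 0 → deg c = γ := by
  constructor
  · intro hf
    induction hf using Submodule.span_induction with
    | mem x hx =>
      obtain ⟨c, hc, rfl⟩ := hx
      intro d hd
      rwa [delta_ne_zero.1 hd]
    | zero => exact fun c hc => (hc rfl).elim
    | add x y _ _ hx hy =>
      intro c hc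
      by_cases h : x c = 0
      · refine hy c fun h' => hc ?_
        rw [add_apply, h, h', add_zero]
      · exact hx c h
    | smul a x _ hx =>
      exact fun c hc => hx c (right_ne_zero_of_mul (smul_apply a x c ▸ hc))
  · exact fun h => mem_of_support fun c hc => Submodule.subset_span ⟨c, h c hc, rfl⟩

theorem delta_mem_piece {Γ : Type*} (deg : IsoClass I → Γ) (c : IsoClass I) :
    delta c ∈ piece deg (deg c) :=
  Submodule.subset_span ⟨c, rfl, rfl⟩

open Classical in
theorem isInternal_piece {Γ : Type*} (deg : IsoClass I → Γ) :
    DirectSum.IsInternal (piece deg) := by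
  rw [DirectSum.isInternal_submodule_iff_iSupIndep_and_iSup_eq_top]
  constructor
  · intro γ
    rw [Submodule.disjoint_def]
    intro f hf hf'
    have key : ∀ c, deg c = γ → f c = 0 := by
      intro c hc
      -- The coordinate at a class of degree `γ` kills every other piece, hence their sum.
      have hle : (⨆ j, ⨆ _ : j ≠ γ, piece deg j) ≤ LinearMap.ker (basis.coord c) := by
        refine iSup₂_le fun j hj g hg => ?_
        by_contra h
        exact hj ((mem_piece.1 hg c h).symm.trans hc)
      exact hle hf'
    refine ext fun M => ?_
    by_contra h
    exact h (key _ (mem_piece.1 hf _ h))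
  · refine eq_top_iff.2 fun f _ => mem_of_support fun c _ => ?_
    exact (le_iSup (piece deg) (deg c)) (delta_mem_piece deg c)

theorem one_mem_piece {Γ : Type*} [AddCommMonoid Γ] {deg : IsoClass I → Γ}
    (hdeg : IsoClass.IsConnectedDegree deg) : 1 ∈ piece deg 0 := by
  rw [← (hdeg.eq_zero_iff 0).2 rfl]
  exact delta_mem_piece deg 0

/-! ### The coproduct in the basis, and cocommutativity -/

section Finite

variable [Finite I]

theorem comul_delta (c : IsoClass I) : CoalgebraStruct.comul (R := ℂ) (delta c) =
    ∑ p ∈ (IsoClass.finite_add_eq c).toFinset, delta p.1 ⊗ₜ[ℂ] delta p.2 := by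
  classical
  refine tensor_ext fun a b => ?_
  rw [comul_apply, map_sum, Finsupp.finsetSum_apply]
  simp only [tensorEquiv_tmul]
  by_cases h : a + b = c
  · rw [Finset.sum_eq_single (a, b)]
    · simp [h, delta_self]
    · rintro ⟨a', b'⟩ _ hne
      by_contra h0
      exact hne (Prod.ext (delta_ne_zero.1 (left_ne_zero_of_mul h0)).symm
        (delta_ne_zero.1 (right_ne_zero_of_mul h0)).symm)
    · simp [h]
  · rw [delta_of_ne h, Finset.sum_eq_zero]
    rintro ⟨a', b'⟩ hp
    by_contra h0
    rw [delta_ne_zero.1 (left_ne_zero_of_mul h0), delta_ne_zero.1 (right_ne_zero_of_mul h0)] at h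
    simp only [Set.Finite.mem_toFinset, Set.mem_ofPred_eq] at hp
    exact h hp

instance isCocomm : Coalgebra.IsCocomm ℂ (HallAlgebra I) where
  comm_comp_comul := by
    have key : ∀ (x : HallAlgebra I ⊗[ℂ] HallAlgebra I) (a b : IsoClass I),
        tensorEquiv (TensorProduct.comm ℂ _ _ x) (a, b) = tensorEquiv x (b, a) := by
      intro x a b
      induction x with
      | zero => simp
      | tmul f g => rw [TensorProduct.comm_tmul, tensorEquiv_tmul, tensorEquiv_tmul, mul_comm]
      | add x y hx hy => simp only [map_add, Finsupp.add_apply, hx, hy]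
    refine LinearMap.ext fun f => tensor_ext fun a b => ?_
    refine (key _ a b).trans ?_
    rw [comul_apply, comul_apply, add_comm]

variable [∀ i j : I, Finite (i ⟶ j)]

/-! ### The antipode -/

open Classical in
/-- The values on the basis of the left convolution inverse of a linear map that sends `1` to `1` and
the basis vector of `c` to `F c`. -/
noncomputable def convInv (F : IsoClass I → HallAlgebra I) (c : IsoClass I) : HallAlgebra I :=
  if c = 0 then 1 else
    -∑ p ∈ (IsoClass.finite_add_eq c).toFinset.attach,
      -- The pair `(c, 0)` carries the unknown value itself and is the term being solved for, so it
      -- is dropped. In all other pairs the first entry is smaller than `c`.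
      if h : p.1.2 = 0 then 0 else
        have : p.1.1.size < c.size := by
          have h1 : p.1.1 + p.1.2 = c := (IsoClass.finite_add_eq c).mem_toFinset.1 p.2
          have h2 := IsoClass.size_pos h
          have h3 := IsoClass.size_add p.1.1 p.1.2
          rw [h1] at h3
          omega
        convInv F p.1.1 * F p.1.2
termination_by c.size

theorem convInv_zero (F : IsoClass I → HallAlgebra I) : convInv F 0 = 1 := by
  rw [convInv, if_pos rfl]

open Classical in
theorem convInv_of_ne (F : IsoClass I → HallAlgebra I) {c : IsoClass I} (hc : c ≠ 0) :
    convInv F c = -∑ p ∈ (IsoClass.finite_add_eq c).toFinset,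
      if p.2 = 0 then 0 else convInv F p.1 * F p.2 := by
  rw [convInv, if_neg hc]
  exact congrArg Neg.neg (Finset.sum_attach (IsoClass.finite_add_eq c).toFinset
    fun p => if p.2 = 0 then 0 else convInv F p.1 * F p.2)

-- At `c ≠ 0` the equation (G ∗ F)(c) = 0 contains G(c)F(0), which equals G(c) because `F 1 = 1`;
-- the recursion for `convInv` is this equation solved for G(c). Only a left inverse results.
open Classical in
theorem exists_convInv (F : HallAlgebra I →ₗ[ℂ] HallAlgebra I) (hF : F 1 = 1) :
    ∃ G : HallAlgebra I →ₗ[ℂ] HallAlgebra I, (∀ c, G (delta c) = convInv (fun c => F (delta c)) c) ∧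
      WithConv.toConv G * WithConv.toConv F = 1 := by
  let G := basis.constr ℂ (convInv fun c => F (delta c))
  have hG : ∀ c, G (delta c) = convInv (fun c => F (delta c)) c := fun c =>
    basis.constr_basis ℂ _ c
  refine ⟨G, hG, ?_⟩
  refine WithConv.ofConv_injective (basis.ext fun c => ?_)
  change LinearMap.mul' ℂ _ (TensorProduct.map G F (CoalgebraStruct.comul (delta c))) =
    algebraMap ℂ _ (delta c 0)
  rw [comul_delta, map_sum, map_sum]
  simp only [TensorProduct.map_tmul, LinearMap.mul'_apply, hG]
  by_cases hc : c = 0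
  · subst hc
    rw [Finset.sum_eq_single (0, 0), convInv_zero, ← one_def, hF, one_mul, one_def, delta_self,
      map_one, one_def]
    · rintro ⟨a, b⟩ h hne
      simp only [Set.Finite.mem_toFinset, Set.mem_ofPred_eq, IsoClass.add_eq_zero] at h
      exact (hne (Prod.ext h.1 h.2)).elim
    · simp
  · rw [delta_of_ne (Ne.symm hc), map_zero,
      ← Finset.sum_filter_add_sum_filter_not _ (fun p => p.2 = 0)]
    have h1 : (IsoClass.finite_add_eq c).toFinset.filter (fun p => p.2 = 0) = {(c, 0)} := by
      ext ⟨a, b⟩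
      simp only [Finset.mem_filter, Set.Finite.mem_toFinset, Set.mem_ofPred_eq,
        Finset.mem_singleton, Prod.mk.injEq]
      constructor
      · rintro ⟨rfl, rfl⟩; simp
      · rintro ⟨rfl, rfl⟩; simp
    rw [h1, Finset.sum_singleton, ← one_def, hF, mul_one, convInv_of_ne _ hc, Finset.sum_filter,
      neg_add_eq_zero]
    refine Finset.sum_congr rfl fun p _ => ?_
    by_cases h : p.2 = 0 <;> simp [h]

/-- The left inverse S of the identity again sends 1 to 1, so it has a left inverse T of its own. In
the convolution monoid, T ∗ S = 1 and S ∗ id = 1 force T = id, which makes S two-sided. -/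
theorem exists_antipode : ∃ S : HallAlgebra I →ₗ[ℂ] HallAlgebra I, IsAntipode ℂ S ∧
    ∀ c, S (delta c) = convInv delta c := by
  obtain ⟨S, hS, hl⟩ := exists_convInv (I := I) LinearMap.id rfl
  obtain ⟨T, -, hT⟩ := exists_convInv S (by rw [one_def, hS, convInv_zero, one_def])
  have hr : WithConv.toConv S * WithConv.toConv (LinearMap.id : HallAlgebra I →ₗ[ℂ] _) = 1 := hl
  have hr' : WithConv.toConv (LinearMap.id : HallAlgebra I →ₗ[ℂ] _) * WithConv.toConv S = 1 := by
    rw [← left_inv_eq_right_inv hT hr]; exact hT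
  exact ⟨S, ⟨congrArg WithConv.ofConv hr, congrArg WithConv.ofConv hr'⟩, hS⟩

/-! ### Gradings -/

theorem mul_mem_piece {Γ : Type*} [AddCommMonoid Γ] {deg : IsoClass I → Γ}
    (hdeg : IsoClass.IsConnectedDegree deg) {α β : Γ} {x y : HallAlgebra I}
    (hx : x ∈ piece deg α) (hy : y ∈ piece deg β) : x * y ∈ piece deg (α + β) := by
  rw [mem_piece] at *
  intro c
  induction c using IsoClass.ind with | _ M
  intro h
  rw [mul_apply] at h
  obtain ⟨L, hL⟩ := not_forall.1 fun h0 => h (finsum_eq_zero_of_forall_eq_zero h0)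
  rw [hdeg.exact M L, hx _ (left_ne_zero_of_mul hL), hy _ (right_ne_zero_of_mul hL)]

/-- The induction runs on `size` and not on `deg`, since `Γ` carries no order. -/
theorem convInv_delta_mem_piece {Γ : Type*} [AddCommMonoid Γ] {deg : IsoClass I → Γ}
    (hdeg : IsoClass.IsConnectedDegree deg) (c : IsoClass I) :
    convInv delta c ∈ piece deg (deg c) := by
  classical
  induction hn : c.size using Nat.strong_induction_on generalizing c with | _ n ih
  by_cases hc : c = 0
  · rw [hc, convInv_zero, (hdeg.eq_zero_iff 0).2 rfl]
    exact one_mem_piece hdeg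
  · rw [convInv_of_ne _ hc]
    refine Submodule.neg_mem _ (Submodule.sum_mem _ fun p hp => ?_)
    have hp' : p.1 + p.2 = c := by simpa using hp
    split_ifs with h
    · exact Submodule.zero_mem _
    · have h2 := IsoClass.size_pos h
      have h3 := IsoClass.size_add p.1 p.2
      rw [← hp', hdeg.map_add]
      refine mul_mem_piece hdeg (ih _ ?_ _ rfl) (delta_mem_piece deg _)
      rw [← hn, ← hp']
      omega

theorem isConnectedHopfGrading_piece {Γ : Type*} [AddCommMonoid Γ] {deg : IsoClass I → Γ}
    (hdeg : IsoClass.IsConnectedDegree deg) {S : HallAlgebra I →ₗ[ℂ] HallAlgebra I}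
    (hS : ∀ c, S (delta c) = convInv delta c) : IsConnectedHopfGrading S (piece deg) where
  isInternal := isInternal_piece deg
  one_mem := one_mem_piece hdeg
  mul_mem _ _ _ hx _ hy := mul_mem_piece hdeg hx hy
  comul_mem γ x hx := by
    induction hx using Submodule.span_induction with
    | mem x hx =>
      obtain ⟨c, rfl, rfl⟩ := hx
      rw [comul_delta]
      refine Submodule.sum_mem _ fun p hp => ?_
      have hp' : p.1 + p.2 = c := by simpa using hp
      refine (le_iSup (fun q : {q : Γ × Γ // q.1 + q.2 = deg c} => LinearMap.range
        (TensorProduct.map (piece deg q.1.1).subtype (piece deg q.1.2).subtype))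
        ⟨(deg p.1, deg p.2), by rw [← hp', hdeg.map_add]⟩) ?_
      exact ⟨⟨_, delta_mem_piece deg p.1⟩ ⊗ₜ ⟨_, delta_mem_piece deg p.2⟩, rfl⟩
    | zero => rw [map_zero]; exact Submodule.zero_mem _
    | add x y _ _ hx hy => rw [map_add]; exact Submodule.add_mem _ hx hy
    | smul a x _ hx => rw [map_smul]; exact Submodule.smul_mem _ _ hx
  counit_eq_zero γ hγ x hx := by
    rw [counit_apply]
    by_contra h
    exact hγ ((mem_piece.1 hx 0 h).symm.trans ((hdeg.eq_zero_iff 0).2 rfl))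
  antipode_mem γ x hx := by
    induction hx using Submodule.span_induction with
    | mem x hx =>
      obtain ⟨c, rfl, rfl⟩ := hx
      rw [hS]
      exact convInv_delta_mem_piece hdeg c
    | zero => rw [map_zero]; exact Submodule.zero_mem _
    | add x y _ _ hx hy => rw [map_add]; exact Submodule.add_mem _ hx hy
    | smul a x _ hx => rw [map_smul]; exact Submodule.smul_mem _ _ hx
  connected := by
    refine congrArg (Submodule.span ℂ) (Set.ext fun f => ?_)
    simp only [Set.mem_ofPred_eq, Set.mem_singleton_iff, hdeg.eq_zero_iff, exists_eq_left, one_def]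

end Finite

end HallAlgebra

/-! ### Indecomposable classes -/

namespace IsoClass

variable {I : Type u} [Quiver.{v} I]

/-- A class is indecomposable if it is non-zero and not the sum of two non-zero classes. -/
def Indecomposable (c : IsoClass I) : Prop := c ≠ 0 ∧ ∀ a b, a + b = c → a = 0 ∨ b = 0

theorem indecomposable_mk {M : F1Rep I} : Indecomposable (mk M) ↔ M.Indecomposable := by
  refine and_congr (not_congr mk_eq_zero) ⟨fun h U W e => ?_, fun h a b => ?_⟩
  · simpa only [mk_eq_zero, IsZeroRep] using h (mk U) (mk W) (mk_eq.2 e).symm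
  · induction a using ind with | _ U
    induction b using ind with | _ W
    intro e
    simpa only [mk_eq_zero, IsZeroRep] using h U W (mk_eq.1 e.symm)

/-- A decomposable class splits into two classes of smaller size. Only existence is claimed. -/
theorem exists_multiset [Finite I] (c : IsoClass I) :
    ∃ s : Multiset {c : IsoClass I // c.Indecomposable}, (s.map Subtype.val).sum = c := by
  induction hn : c.size using Nat.strong_induction_on generalizing c with | _ n ih
  by_cases h0 : c = 0
  · exact ⟨0, by simp [h0]⟩
  by_cases hc : c.Indecomposable
  · exact ⟨{⟨c, hc⟩}, by simp⟩
  have : ∃ a b, a + b = c ∧ a ≠ 0 ∧ b ≠ 0 := by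
    by_contra! h
    exact hc ⟨h0, fun a b e => or_iff_not_imp_left.2 fun ha => h a b e ha⟩
  obtain ⟨a, b, rfl, ha, hb⟩ := this
  have h1 := size_pos ha
  have h2 := size_pos hb
  rw [size_add] at hn
  obtain ⟨s, rfl⟩ := ih _ (by omega) a rfl
  obtain ⟨t, rfl⟩ := ih _ (by omega) b rfl
  exact ⟨s + t, by simp⟩

end IsoClass

namespace HallAlgebra

variable {I : Type u} [Quiver.{v} I]

/-! ### Primitive elements -/

theorem one_apply_zero : (1 : HallAlgebra I) 0 = 1 := by
  rw [one_def, delta_self]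

theorem one_apply_of_ne {c : IsoClass I} (hc : c ≠ 0) : (1 : HallAlgebra I) c = 0 := by
  rw [one_def, delta_of_ne hc]

variable [Finite I] [∀ i j : I, Finite (i ⟶ j)]

theorem mem_nilLie_iff {x : HallAlgebra I} : x ∈ nilLie I ↔
    CoalgebraStruct.comul (R := ℂ) x = x ⊗ₜ[ℂ] 1 + 1 ⊗ₜ[ℂ] x := Iff.rfl

theorem mem_nilLie_iff_apply {x : HallAlgebra I} : x ∈ nilLie I ↔
    ∀ a b, x (a + b) = x a * (1 : HallAlgebra I) b + (1 : HallAlgebra I) a * x b := by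
  rw [mem_nilLie_iff]
  constructor
  · intro h a b
    rw [← comul_apply, h, map_add, Finsupp.add_apply, tensorEquiv_tmul, tensorEquiv_tmul]
  · intro h
    refine tensor_ext fun a b => ?_
    rw [comul_apply, h, map_add, Finsupp.add_apply, tensorEquiv_tmul, tensorEquiv_tmul]

theorem apply_zero_of_mem_nilLie {x : HallAlgebra I} (hx : x ∈ nilLie I) : x 0 = 0 := by
  have h := mem_nilLie_iff_apply.1 hx 0 0
  rw [one_apply_zero, add_zero, mul_one, one_mul] at h
  exact left_eq_add.1 h

/-- For a, b both non-zero the right side of the primitivity equation is zero, so `x` vanishes on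
decomposables; a = b = 0 gives x(0) = 2x(0). Conversely, when a or b is zero the equation follows
from x(0) = 0. -/
theorem mem_nilLie_iff_support {x : HallAlgebra I} :
    x ∈ nilLie I ↔ ∀ c, x c ≠ 0 → c.Indecomposable := by
  constructor
  · intro hx c hc
    refine ⟨fun h => hc (h ▸ apply_zero_of_mem_nilLie hx), fun a b h => ?_⟩
    by_contra! hab
    refine hc ?_
    rw [← h, mem_nilLie_iff_apply.1 hx, one_apply_of_ne hab.1, one_apply_of_ne hab.2]
    simp
  · intro h
    have h0 : x 0 = 0 := by
      by_contra h0
      exact (h 0 h0).1 rfl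
    refine mem_nilLie_iff_apply.2 fun a b => ?_
    by_cases ha : a = 0
    · rw [ha, zero_add, h0, one_apply_zero, zero_mul, one_mul, zero_add]
    by_cases hb : b = 0
    · rw [hb, add_zero, h0, one_apply_zero, mul_zero, mul_one, add_zero]
    rw [one_apply_of_ne ha, one_apply_of_ne hb, mul_zero, zero_mul, add_zero]
    by_contra hc
    exact ((h _ hc).2 a b rfl).elim ha hb

theorem delta_mem_nilLie {c : IsoClass I} (hc : c.Indecomposable) : delta c ∈ nilLie I :=
  mem_nilLie_iff_support.2 fun _ hd => delta_ne_zero.1 hd ▸ hc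

theorem nilLie_eq_span : (nilLie I).toSubmodule = Submodule.span ℂ
    {f | ∃ M : F1Rep I, M.Indecomposable ∧ f = delta (IsoClass.mk M)} := by
  refine le_antisymm (fun x hx => mem_of_support fun c => ?_) (Submodule.span_le.2 ?_)
  · induction c using IsoClass.ind with | _ M
    intro hc
    exact Submodule.subset_span
      ⟨M, IsoClass.indecomposable_mk.1 (mem_nilLie_iff_support.1 hx _ hc), rfl⟩
  · rintro _ ⟨M, hM, rfl⟩
    exact delta_mem_nilLie (IsoClass.indecomposable_mk.2 hM)

/-! ### Pro-nilpotency -/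

/-- If `x` vanishes at zero and `y` vanishes up to size `k`, then both products vanish up to size
`k + 1`. -/
theorem mul_apply_eq_zero_of_size {x y : HallAlgebra I} (hx : x 0 = 0) {k : ℕ}
    (hy : ∀ c, c.size < k → y c = 0) {c : IsoClass I} (hc : c.size < k + 1) :
    (x * y) c = 0 ∧ (y * x) c = 0 := by
  induction c using IsoClass.ind with | _ M
  have key : ∀ a b : IsoClass I, a.size + b.size < k + 1 → x a * y b = 0 := by
    intro a b h
    by_cases ha : a = 0
    · rw [ha, hx, zero_mul]
    · have := IsoClass.size_pos ha
      rw [hy b (by omega), mul_zero]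
  constructor
  · refine finsum_eq_zero_of_forall_eq_zero fun L => key _ _ ?_
    rwa [← IsoClass.size_eq L]
  · refine finsum_eq_zero_of_forall_eq_zero fun L => ?_
    rw [mul_comm]
    refine key _ _ ?_
    rwa [add_comm, ← IsoClass.size_eq L]

theorem lie_apply_eq_zero_of_size (x y : nilLie I) {k : ℕ}
    (hy : ∀ c, c.size < k → (y : HallAlgebra I) c = 0) {c : IsoClass I} (hc : c.size < k + 1) :
    (⁅x, y⁆ : nilLie I).1 c = 0 := by
  obtain ⟨h1, h2⟩ := mul_apply_eq_zero_of_size (apply_zero_of_mem_nilLie x.2) hy hc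
  -- The additive form lets the identity be evaluated pointwise with `add_apply`.
  have h3 : (⁅x, y⁆ : nilLie I).1 + y.1 * x.1 = x.1 * y.1 := by
    rw [LieSubalgebra.coe_bracket, LieRing.of_associative_ring_bracket, sub_add_cancel]
  have h4 := congrArg (fun f : HallAlgebra I => f c) h3
  simpa only [add_apply, h1, h2, add_zero] using h4

/-- The ideal of primitive elements that vanish on the classes of size less than `k`. -/
def sizeIdeal (I : Type u) [Quiver.{v} I] [Finite I] [∀ i j : I, Finite (i ⟶ j)] (k : ℕ) :
    LieIdeal ℂ (nilLie I) where
  carrier := {x | ∀ c : IsoClass I, c.size < k → x.1 c = 0}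
  zero_mem' _ _ := rfl
  add_mem' {x y} hx hy c hc := by
    change x.1 c + y.1 c = 0
    rw [hx c hc, hy c hc, add_zero]
  smul_mem' a x hx c hc := by
    change a * x.1 c = 0
    rw [hx c hc, mul_zero]
  lie_mem {x y} hy c hc := lie_apply_eq_zero_of_size x y hy (Nat.lt_succ_of_lt hc)

/-- Each bracket gains one in the order of vanishing; at `k = 0` the vanishing condition is void. -/
theorem lowerCentralSeries_le_sizeIdeal (k : ℕ) :
    LieModule.lowerCentralSeries ℂ (nilLie I) (nilLie I) k ≤ sizeIdeal I k := by
  induction k with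
  | zero => exact fun x _ c hc => absurd hc (Nat.not_lt_zero _)
  | succ k ih =>
    rw [LieModule.lowerCentralSeries_succ, LieSubmodule.lieIdeal_oper_eq_span, LieSubmodule.lieSpan_le]
    rintro _ ⟨x, y, rfl⟩
    exact fun c hc => lie_apply_eq_zero_of_size x.1 y.1 (ih y.2) hc

theorem finiteDimensional_quotient_sizeIdeal (k : ℕ) :
    FiniteDimensional ℂ (nilLie I ⧸ sizeIdeal I k) := by
  let s : Set (IsoClass I) := {c | c.size ≤ k}
  have : Finite s := IsoClass.finite_size_le k
  let ev : nilLie I →ₗ[ℂ] (s → ℂ) :=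
    { toFun := fun x c => x.1 c.1
      map_add' := fun _ _ => rfl
      map_smul' := fun _ _ => rfl }
  -- Evaluating at sizes up to `k` inclusive asks for more than the ideal does, so the quotient by
  -- the ideal is a quotient of the finite-dimensional quotient by this kernel.
  have h : LinearMap.ker ev ≤ (sizeIdeal I k).toSubmodule :=
    fun x hx c hc => congrFun (show ev x = 0 from hx) ⟨c, hc.le⟩
  have : FiniteDimensional ℂ (nilLie I ⧸ LinearMap.ker ev) :=
    Module.Finite.equiv ev.quotKerEquivRange.symm
  exact Module.Finite.of_surjective (Submodule.factor h) (Submodule.factor_surjective h)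

theorem isProNilpotent_nilLie : IsProNilpotent (nilLie I) := by
  refine ⟨sizeIdeal I, fun j k hjk x hx c hc => hx c (hc.trans_le hjk), ?_, fun k =>
    ⟨finiteDimensional_quotient_sizeIdeal k, ?_⟩⟩
  · refine (LieSubmodule.eq_bot_iff _).2 fun x hx => Subtype.ext (ext fun M => ?_)
    rw [LieSubmodule.mem_iInf] at hx
    -- The value at `M` is killed by the ideal of index one more than the size of `M`.
    exact hx _ (IsoClass.mk M) (Nat.lt_succ_self _)
  · have h : LieModule.IsNilpotent (nilLie I) (nilLie I ⧸ sizeIdeal I k) :=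
      (LieModule.isNilpotent_quotient_iff ℂ _ _ _).2 ⟨k, lowerCentralSeries_le_sizeIdeal k⟩
    -- So far the quotient is nilpotent as a module over `nilLie I`. Its lower central series as a
    -- Lie algebra has the same underlying subspaces.
    rw [LieModule.isNilpotent_iff ℂ] at h
    rw [LieRing.IsNilpotent, LieModule.isNilpotent_iff ℂ]
    peel h with n hn
    rw [← LieSubmodule.toSubmodule_inj, ← coe_lowerCentralSeries_ideal_quot_eq, hn,
      LieSubmodule.bot_toSubmodule, LieSubmodule.bot_toSubmodule]

end HallAlgebra

/-! ### Products of primitive elements evaluated on direct sums -/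

namespace HallAlgebra

variable {I : Type u} [Quiver.{v} I]

/-- The linear map `u ⊗ v ↦ v(b) u`. -/
noncomputable def slice (b : IsoClass I) : HallAlgebra I ⊗[ℂ] HallAlgebra I →ₗ[ℂ] HallAlgebra I :=
  (TensorProduct.rid ℂ _).toLinearMap ∘ₗ (basis.coord b).lTensor (HallAlgebra I)

theorem slice_tmul (b : IsoClass I) (f g : HallAlgebra I) : slice b (f ⊗ₜ g) = g b • f := rfl

theorem slice_apply (b : IsoClass I) (z : HallAlgebra I ⊗[ℂ] HallAlgebra I) (a : IsoClass I) :
    slice b z a = tensorEquiv z (a, b) := by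
  induction z with
  | zero => simp [zero_apply]
  | tmul f g => rw [slice_tmul, smul_apply, tensorEquiv_tmul, mul_comm]
  | add x y hx hy => simp only [map_add, Finsupp.add_apply, add_apply, hx, hy]

/-- The translate `c ↦ f(c + b)` of a function `f`. -/
noncomputable def translate [Finite I] (b : IsoClass I) (f : HallAlgebra I) : HallAlgebra I :=
  slice b (CoalgebraStruct.comul (R := ℂ) f)

theorem translate_apply [Finite I] (b : IsoClass I) (f : HallAlgebra I) (a : IsoClass I) :
    translate b f a = f (a + b) := by
  rw [translate, slice_apply, comul_apply]

theorem translate_translate [Finite I] (a b : IsoClass I) (f : HallAlgebra I) :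
    translate a (translate b f) = translate (b + a) f := by
  refine ext fun M => ?_
  rw [translate_apply, translate_apply, translate_apply, add_assoc, add_comm a b]

theorem translate_zero [Finite I] (f : HallAlgebra I) : translate 0 f = f :=
  ext fun M => by rw [translate_apply, add_zero]

/-! ### The filtration by the number of summands -/

/-- The function `f` vanishes on all sums of more than `k` non-zero classes. -/
def VanishesAbove (k : ℕ) (f : HallAlgebra I) : Prop :=
  ∀ s : Multiset (IsoClass I), 0 ∉ s → k < s.card → f s.sum = 0

theorem vanishesAbove_one : VanishesAbove 0 (1 : HallAlgebra I) := by
  intro s hs hc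
  obtain ⟨a, ha⟩ := Multiset.card_pos_iff_exists_mem.1 hc
  obtain ⟨t, rfl⟩ := Multiset.exists_cons_of_mem ha
  refine one_apply_of_ne fun h => hs ?_
  rw [Multiset.sum_cons, IsoClass.add_eq_zero] at h
  exact h.1 ▸ ha

theorem zero_notMem_map_val (s : Multiset {c : IsoClass I // c.Indecomposable}) :
    0 ∉ s.map Subtype.val := by
  rintro h
  obtain ⟨p, -, hp⟩ := Multiset.mem_map.1 h
  exact p.2.1 hp

variable [Finite I] [∀ i j : I, Finite (i ⟶ j)]

theorem tensorEquiv_tmul_one_mul (x : HallAlgebra I) (z : HallAlgebra I ⊗[ℂ] HallAlgebra I)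
    (a b : IsoClass I) : tensorEquiv ((x ⊗ₜ 1) * z) (a, b) = (x * slice b z) a := by
  induction z with
  | zero => simp [zero_apply]
  | tmul f g =>
    rw [Algebra.TensorProduct.tmul_mul_tmul, tensorEquiv_tmul, slice_tmul, mul_smul_comm, smul_apply,
      one_mul, mul_comm]
  | add z w hz hw => simp only [mul_add, map_add, Finsupp.add_apply, add_apply, hz, hw]

theorem tensorEquiv_one_tmul_mul (x : HallAlgebra I) (z : HallAlgebra I ⊗[ℂ] HallAlgebra I)
    (a b : IsoClass I) : tensorEquiv ((1 ⊗ₜ x) * z) (a, b) =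
      (x * slice a (TensorProduct.comm ℂ _ _ z)) b := by
  induction z with
  | zero => simp [zero_apply]
  | tmul f g =>
    rw [Algebra.TensorProduct.tmul_mul_tmul, tensorEquiv_tmul, TensorProduct.comm_tmul, slice_tmul,
      mul_smul_comm, smul_apply, one_mul]
  | add z w hz hw => simp only [mul_add, map_add, Finsupp.add_apply, add_apply, hz, hw]

/-- This is Δ(xf) = (x ⊗ 1 + 1 ⊗ x)Δ(f) read at `(a, b)`; cocommutativity turns the slice in the
first factor into a translate. -/
theorem mul_apply_add {x : HallAlgebra I} (hx : x ∈ nilLie I) (f : HallAlgebra I)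
    (a b : IsoClass I) : (x * f) (a + b) = (x * translate b f) a + (x * translate a f) b := by
  rw [← comul_apply, Bialgebra.comul_mul, mem_nilLie_iff.1 hx, add_mul, map_add, Finsupp.add_apply,
    tensorEquiv_tmul_one_mul, tensorEquiv_one_tmul_mul, Coalgebra.comm_comul]
  rfl

-- Iterating the two-term formula, a primitive factor acts on one summand at a time while the
-- remaining summands are absorbed by the other factor.
open Classical in
theorem mul_apply_sum {x : HallAlgebra I} (hx : x ∈ nilLie I) (s : Multiset (IsoClass I))
    (f : HallAlgebra I) :
    (x * f) s.sum = (s.map fun a => (x * translate (s.erase a).sum f) a).sum := by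
  induction s using Multiset.induction_on generalizing f with
  | empty =>
    rw [Multiset.map_zero, Multiset.sum_zero, Multiset.sum_zero]
    have h := mul_apply_add hx f 0 0
    rw [translate_zero, add_zero] at h
    exact left_eq_add.1 h
  | cons a s ih =>
    rw [Multiset.sum_cons, mul_apply_add hx, ih, Multiset.map_cons, Multiset.sum_cons,
      Multiset.erase_cons_head]
    refine congrArg _ (congrArg _ (Multiset.map_congr rfl fun b hb => ?_))
    rw [translate_translate, Multiset.erase_cons_tail_of_mem hb, Multiset.sum_cons]

/-- Once `k` non-zero summands are absorbed, any further non-zero class gives zero, so only the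
value at 0 survives. -/
theorem VanishesAbove.translate_eq {k : ℕ} {f : HallAlgebra I} (hf : VanishesAbove k f)
    {s : Multiset (IsoClass I)} (hs : 0 ∉ s) (hc : k ≤ s.card) :
    translate s.sum f = f s.sum • 1 := by
  refine ext fun M => ?_
  rw [translate_apply, smul_apply]
  by_cases h : IsoClass.mk M = 0
  · rw [h, zero_add, one_apply_zero, mul_one]
  · rw [one_apply_of_ne h, mul_zero, ← Multiset.sum_cons]
    refine hf _ ?_ ?_
    · rw [Multiset.mem_cons, not_or]
      exact ⟨Ne.symm h, hs⟩
    · rw [Multiset.card_cons]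
      omega

-- A Leibniz rule: after `a` is removed at least `k` summands remain, so the translate of `f` is a
-- scalar and x · f becomes a multiple of x.
open Classical in
theorem VanishesAbove.mul_apply_sum {k : ℕ} {f x : HallAlgebra I} (hf : VanishesAbove k f)
    (hx : x ∈ nilLie I) {s : Multiset (IsoClass I)} (hs : 0 ∉ s) (hc : k < s.card) :
    (x * f) s.sum = (s.map fun a => f (s.erase a).sum * x a).sum := by
  rw [HallAlgebra.mul_apply_sum hx]
  refine congrArg _ (Multiset.map_congr rfl fun a ha => ?_)
  rw [hf.translate_eq (fun h => hs (Multiset.mem_of_mem_erase h)), mul_smul_comm, mul_one, smul_apply]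
  have := Multiset.card_erase_add_one ha
  omega

theorem VanishesAbove.mul {k : ℕ} {f x : HallAlgebra I} (hf : VanishesAbove k f)
    (hx : x ∈ nilLie I) : VanishesAbove (k + 1) (x * f) := by
  classical
  intro s hs hc
  rw [hf.mul_apply_sum hx hs (by omega)]
  refine Multiset.sum_eq_zero fun y hy => ?_
  obtain ⟨a, ha, rfl⟩ := Multiset.mem_map.1 hy
  have := Multiset.card_erase_add_one ha
  rw [hf _ (fun h => hs (Multiset.mem_of_mem_erase h)) (by omega), zero_mul]

open Classical in
theorem VanishesAbove.delta_mul_apply_sum {k : ℕ} {f : HallAlgebra I} (hf : VanishesAbove k f)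
    {p : IsoClass I} (hp : p.Indecomposable) {s : Multiset (IsoClass I)} (hs : 0 ∉ s)
    (hc : k < s.card) : (delta p * f) s.sum = s.count p * f (s.erase p).sum := by
  rw [hf.mul_apply_sum (delta_mem_nilLie hp) hs hc]
  have h : ∀ a, f (s.erase a).sum * delta p a = if p = a then f (s.erase p).sum else 0 := by
    intro a
    by_cases ha : p = a
    · rw [if_pos ha, ← ha, delta_self, mul_one]
    · rw [if_neg ha, delta_of_ne (Ne.symm ha), mul_zero]
  simp only [h]
  -- Freezing this value leaves an induction on `s` that only counts occurrences of `p`.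
  generalize f (s.erase p).sum = y
  clear hs hc h
  induction s using Multiset.induction_on with
  | empty => simp
  | cons a s ih =>
    rw [Multiset.map_cons, Multiset.sum_cons, ih, Multiset.count_cons]
    split_ifs <;> push_cast <;> ring

/-! ### Monomials in the indecomposables, and triangularity -/

/-- The product of the delta functions of a list of indecomposable classes. -/
noncomputable def deltaProd (l : List {c : IsoClass I // c.Indecomposable}) : HallAlgebra I :=
  (l.map fun p => delta p.1).prod

theorem vanishesAbove_deltaProd (l : List {c : IsoClass I // c.Indecomposable}) :
    VanishesAbove l.length (deltaProd l) := by
  induction l with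
  | nil => exact vanishesAbove_one
  | cons p l ih =>
    rw [deltaProd, List.map_cons, List.prod_cons]
    exact ih.mul (delta_mem_nilLie p.2)

/-- Peeling off the first factor `p` multiplies by the multiplicity of `p` in `s` and removes one
copy of it. These multiplicities are non-zero in ℂ exactly when `p` occurs, so the value survives
only if `l` exhausts `s`. -/
theorem deltaProd_apply_ne_zero_iff (l : List {c : IsoClass I // c.Indecomposable})
    (s : Multiset {c : IsoClass I // c.Indecomposable}) (hs : s.card = l.length) :
    deltaProd l (s.map Subtype.val).sum ≠ 0 ↔ (l : Multiset _) = s := by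
  classical
  induction l generalizing s with
  | nil =>
    obtain rfl := Multiset.card_eq_zero.1 hs
    simp [deltaProd, one_apply_zero]
  | cons p l ih =>
    rw [List.length_cons] at hs
    rw [deltaProd, List.map_cons, List.prod_cons, ← deltaProd,
      (vanishesAbove_deltaProd l).delta_mul_apply_sum p.2 (zero_notMem_map_val s)
        (by rw [Multiset.card_map]; omega), Multiset.count_map_eq_count' _ _ Subtype.val_injective,
      ← Multiset.map_erase _ Subtype.val_injective, ← Multiset.cons_coe]
    by_cases hp : p ∈ s
    · have h1 := Multiset.card_erase_add_one hp
      rw [mul_ne_zero_iff, ih _ (by omega), Nat.cast_ne_zero, Multiset.count_ne_zero]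
      constructor
      · rintro ⟨-, h⟩
        rw [h, Multiset.cons_erase hp]
      · rintro rfl
        exact ⟨hp, by rw [Multiset.erase_cons_head]⟩
    · rw [Multiset.count_eq_zero_of_notMem hp, Nat.cast_zero, zero_mul]
      refine iff_of_false (fun h => h rfl) ?_
      rintro rfl
      exact hp (Multiset.mem_cons_self _ _)

theorem linearIndependent_deltaProd : LinearIndependent ℂ
    fun s : Multiset {c : IsoClass I // c.Indecomposable} => deltaProd s.toList := by
  classical
  rw [linearIndependent_iff']
  intro t g hg
  by_contra! h
  obtain ⟨i, hi, hgi⟩ := h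
  -- Evaluating a relation at the sum of a multiset `s` of largest cardinality isolates its
  -- coefficient: shorter monomials vanish there by the filtration, those of equal length by
  -- `deltaProd_apply_ne_zero_iff`.
  obtain ⟨s, hs, hmax⟩ := (t.filter fun s => g s ≠ 0).exists_max_image Multiset.card
    ⟨i, Finset.mem_filter.2 ⟨hi, hgi⟩⟩
  rw [Finset.mem_filter] at hs
  have h0 := congrArg (basis.coord (s.map Subtype.val).sum) hg
  rw [map_sum, map_zero, Finset.sum_eq_single s] at h0
  · rw [map_smul] at h0
    exact (mul_ne_zero hs.2 ((deltaProd_apply_ne_zero_iff s.toList s (by simp)).2 (by simp))) h0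
  · intro r hr hrs
    rw [map_smul]
    change g r * deltaProd r.toList (s.map Subtype.val).sum = 0
    by_cases hgr : g r = 0
    · rw [hgr, zero_mul]
    have hle := hmax r (Finset.mem_filter.2 ⟨hr, hgr⟩)
    rcases hle.lt_or_eq with hlt | heq
    · rw [vanishesAbove_deltaProd r.toList _ (zero_notMem_map_val s) (by simpa using hlt), mul_zero]
    · have := not_iff_not.2 (deltaProd_apply_ne_zero_iff r.toList s (by simpa using heq.symm))
      rw [not_not.1 (this.2 (by simpa using hrs)), mul_zero]
  · exact fun h => (h hs.1).elim

/-- Up to a non-zero scalar, the monomial of `s` is the delta function at its sum plus terms at sums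
of strictly fewer indecomposables, which induction handles. -/
theorem delta_mem_span_deltaProd (s : Multiset {c : IsoClass I // c.Indecomposable}) :
    delta (s.map Subtype.val).sum ∈ Submodule.span ℂ (Set.range (deltaProd (I := I))) := by
  induction hn : s.card using Nat.strong_induction_on generalizing s with | _ n ih
  let c := (s.map Subtype.val).sum
  have hc : deltaProd s.toList c ≠ 0 :=
    (deltaProd_apply_ne_zero_iff s.toList s (by simp)).2 (by simp)
  have h : deltaProd s.toList - deltaProd s.toList c • delta c ∈
      Submodule.span ℂ (Set.range (deltaProd (I := I))) := by
    refine mem_of_support fun d hd => ?_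
    have hd' : d ≠ c ∧ deltaProd s.toList d ≠ 0 := by
      have h1 : (deltaProd s.toList - deltaProd s.toList c • delta c) d =
          deltaProd s.toList d - deltaProd s.toList c * delta c d := rfl
      rw [h1] at hd
      by_cases hdc : d = c
      · rw [hdc, delta_self, mul_one, sub_self] at hd
        exact (hd rfl).elim
      · rw [delta_of_ne hdc, mul_zero, sub_zero] at hd
        exact ⟨hdc, hd⟩
    obtain ⟨t, rfl⟩ := IsoClass.exists_multiset d
    have hle : t.card ≤ s.card := by
      by_contra! hlt
      exact hd'.2 (vanishesAbove_deltaProd s.toList _ (zero_notMem_map_val t) (by simpa using hlt))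
    rcases hle.lt_or_eq with hlt | heq
    · exact ih _ (hn ▸ hlt) t rfl
    · refine (hd'.1 ?_).elim
      rw [← (deltaProd_apply_ne_zero_iff s.toList t (by simpa using heq)).1 hd'.2]
      simp [c]
  have h' := Submodule.sub_mem _ (Submodule.subset_span (Set.mem_range_self s.toList)) h
  rw [sub_sub_cancel] at h'
  exact (Submodule.smul_mem_iff _ hc).1 h'

theorem span_deltaProd : Submodule.span ℂ (Set.range (deltaProd (I := I))) = ⊤ := by
  refine eq_top_iff.2 fun f _ => mem_of_support fun c _ => ?_
  obtain ⟨s, rfl⟩ := IsoClass.exists_multiset c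
  exact delta_mem_span_deltaProd s

end HallAlgebra

/-! ### The enveloping algebra of the Lie algebra of primitive elements -/

namespace HallAlgebra

variable {I : Type u} [Quiver.{v} I] [Finite I] [∀ i j : I, Finite (i ⟶ j)]

/-- The generator of the enveloping algebra given by an indecomposable class. -/
noncomputable def envGen (p : {c : IsoClass I // c.Indecomposable}) :
    UniversalEnvelopingAlgebra ℂ (nilLie I) :=
  UniversalEnvelopingAlgebra.ι ℂ ⟨delta p.1, delta_mem_nilLie p.2⟩

/-- The product of the generators in a list. -/
noncomputable def envProd (l : List {c : IsoClass I // c.Indecomposable}) :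
    UniversalEnvelopingAlgebra ℂ (nilLie I) :=
  (l.map envGen).prod

/-- Lets statements linear in a primitive element be checked on indecomposable delta functions. -/
theorem map_mem_of_delta_mem {V : Type*} [AddCommGroup V] [Module ℂ V] (g : nilLie I →ₗ[ℂ] V)
    (S : Submodule ℂ V)
    (h : ∀ p : {c : IsoClass I // c.Indecomposable}, g ⟨delta p.1, delta_mem_nilLie p.2⟩ ∈ S)
    (x : nilLie I) : g x ∈ S := by
  have hx : x.1 ∈ (S.comap g).map (nilLie I).toSubmodule.subtype := by
    refine mem_of_support fun c hc => ?_
    have hc' := mem_nilLie_iff_support.1 x.2 c hc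
    exact ⟨⟨delta c, delta_mem_nilLie hc'⟩, h ⟨c, hc'⟩, rfl⟩
  obtain ⟨y, hy, hyx⟩ := hx
  rwa [show x = y from Subtype.ext hyx.symm]

/-- The span of the products of fewer than `n` generators. -/
noncomputable def envFiltration (I : Type u) [Quiver.{v} I] [Finite I]
    [∀ i j : I, Finite (i ⟶ j)] (n : ℕ) : Submodule ℂ (UniversalEnvelopingAlgebra ℂ (nilLie I)) :=
  Submodule.span ℂ {u | ∃ l : List {c : IsoClass I // c.Indecomposable}, l.length < n ∧ u = envProd l}

theorem envProd_mem_envFiltration {l : List {c : IsoClass I // c.Indecomposable}} {n : ℕ}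
    (h : l.length < n) : envProd l ∈ envFiltration I n :=
  Submodule.subset_span ⟨l, h, rfl⟩

theorem ι_mul_mem_envFiltration (x : nilLie I) {n : ℕ}
    {u : UniversalEnvelopingAlgebra ℂ (nilLie I)} (hu : u ∈ envFiltration I n) :
    UniversalEnvelopingAlgebra.ι ℂ x * u ∈ envFiltration I (n + 1) := by
  refine map_mem_of_delta_mem ((LinearMap.mulRight ℂ u) ∘ₗ
    (UniversalEnvelopingAlgebra.ι ℂ : nilLie I →ₗ⁅ℂ⁆ _).toLinearMap) _ (fun p => ?_) x
  change envGen p * u ∈ _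
  induction hu using Submodule.span_induction with
  | mem u hu =>
    obtain ⟨l, hl, rfl⟩ := hu
    exact Submodule.subset_span ⟨p :: l, by simpa using hl, by simp [envProd]⟩
  | zero => rw [mul_zero]; exact Submodule.zero_mem _
  | add u v _ _ hu hv => rw [mul_add]; exact Submodule.add_mem _ hu hv
  | smul a u _ hu => rw [mul_smul_comm]; exact Submodule.smul_mem _ _ hu

/-- Swapping two neighbours changes the product by a commutator, which lies in the image of the Lie
algebra and so is a combination of single generators: one factor is lost. -/
theorem envProd_sub_mem_of_perm {l l' : List {c : IsoClass I // c.Indecomposable}}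
    (h : l.Perm l') : envProd l - envProd l' ∈ envFiltration I l.length := by
  induction h with
  | nil => rw [sub_self]; exact Submodule.zero_mem _
  | cons p _ ih =>
    simp only [envProd, List.map_cons, List.prod_cons, List.length_cons, ← mul_sub] at *
    exact ι_mul_mem_envFiltration _ ih
  | swap p q l =>
    simp only [envProd, List.map_cons, List.prod_cons, List.length_cons, ← mul_assoc, ← sub_mul]
    have h : envGen q * envGen p - envGen p * envGen q =
        UniversalEnvelopingAlgebra.ι ℂ ⁅(⟨delta q.1, delta_mem_nilLie q.2⟩ : nilLie I),
          (⟨delta p.1, delta_mem_nilLie p.2⟩ : nilLie I)⁆ := by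
      rw [LieHom.map_lie, LieRing.of_associative_ring_bracket]
      rfl
    rw [h]
    exact ι_mul_mem_envFiltration _ (envProd_mem_envFiltration (Nat.lt_succ_self _))
  | trans h _ ih ih' =>
    rw [← sub_add_sub_cancel]
    rw [← h.length_eq] at ih'
    exact Submodule.add_mem _ ih ih'

/-- Replace `l` by the list chosen for its multiset; the error is a combination of shorter products,
covered by induction on length. -/
theorem envProd_mem_span_toList (l : List {c : IsoClass I // c.Indecomposable}) :
    envProd l ∈ Submodule.span ℂ (Set.range
      fun s : Multiset {c : IsoClass I // c.Indecomposable} => envProd s.toList) := by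
  induction hn : l.length using Nat.strong_induction_on generalizing l with | _ n ih
  have hp : l.Perm (l : Multiset _).toList := Multiset.coe_eq_coe.1 (Multiset.coe_toList _).symm
  have hle : envFiltration I l.length ≤ Submodule.span ℂ (Set.range
      fun s : Multiset {c : IsoClass I // c.Indecomposable} => envProd s.toList) := by
    refine Submodule.span_le.2 ?_
    rintro _ ⟨l', hl', rfl⟩
    exact ih _ (hn ▸ hl') l' rfl
  rw [← sub_add_cancel (envProd l) (envProd (l : Multiset _).toList)]
  exact Submodule.add_mem _ (hle (envProd_sub_mem_of_perm hp))
    (Submodule.subset_span ⟨(l : Multiset _), rfl⟩)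

theorem adjoin_range_envGen : Algebra.adjoin ℂ (Set.range (envGen (I := I))) = ⊤ := by
  let A := Algebra.adjoin ℂ (Set.range (envGen (I := I)))
  have hA : ∀ x : nilLie I, UniversalEnvelopingAlgebra.ι ℂ x ∈ A := fun x =>
    map_mem_of_delta_mem (UniversalEnvelopingAlgebra.ι ℂ : nilLie I →ₗ⁅ℂ⁆ _).toLinearMap
      (Subalgebra.toSubmodule A) (fun p => Algebra.subset_adjoin ⟨p, rfl⟩) x
  let g : nilLie I →ₗ⁅ℂ⁆ A :=
    { toFun := fun x => ⟨UniversalEnvelopingAlgebra.ι ℂ x, hA x⟩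
      map_add' := fun x y => Subtype.ext (map_add _ x y)
      map_smul' := fun a x => Subtype.ext (map_smul _ a x)
      map_lie' := fun {x y} => Subtype.ext (LieHom.map_lie _ x y) }
  -- By the universal property, the lift into the generated subalgebra followed by inclusion is the
  -- identity, so the subalgebra is everything.
  have h : A.val.comp (UniversalEnvelopingAlgebra.lift ℂ g) = AlgHom.id ℂ _ := by
    refine UniversalEnvelopingAlgebra.hom_ext ℂ (LieHom.ext fun x => ?_)
    change ((UniversalEnvelopingAlgebra.lift ℂ g (UniversalEnvelopingAlgebra.ι ℂ x) : A) :
      UniversalEnvelopingAlgebra ℂ (nilLie I)) = _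
    rw [UniversalEnvelopingAlgebra.lift_ι_apply]
    rfl
  refine eq_top_iff.2 fun u _ => ?_
  rw [← AlgHom.id_apply (R := ℂ) u, ← h]
  exact (UniversalEnvelopingAlgebra.lift ℂ g u).2

theorem span_envProd_toList : Submodule.span ℂ (Set.range
    fun s : Multiset {c : IsoClass I // c.Indecomposable} => envProd s.toList) = ⊤ := by
  rw [← top_le_iff, ← Algebra.top_toSubmodule, ← adjoin_range_envGen, Algebra.adjoin_eq_span,
    Submodule.span_le]
  intro u hu
  obtain ⟨l, hl, rfl⟩ := Submonoid.exists_list_of_mem_closure hu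
  obtain ⟨l, rfl⟩ : l ∈ Set.range (List.map envGen) := by
    rw [Set.range_list_map]; exact hl
  exact envProd_mem_span_toList l

/-- The algebra homomorphism from the enveloping algebra that extends the inclusion. -/
noncomputable def envHom (I : Type u) [Quiver.{v} I] [Finite I] [∀ i j : I, Finite (i ⟶ j)] :
    UniversalEnvelopingAlgebra ℂ (nilLie I) →ₐ[ℂ] HallAlgebra I :=
  UniversalEnvelopingAlgebra.lift ℂ (nilLie I).incl

theorem envHom_ι (x : nilLie I) : envHom I (UniversalEnvelopingAlgebra.ι ℂ x) = x :=
  UniversalEnvelopingAlgebra.lift_ι_apply ℂ _ x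

theorem envHom_envProd (l : List {c : IsoClass I // c.Indecomposable}) :
    envHom I (envProd l) = deltaProd l := by
  rw [envProd, map_list_prod, List.map_map, deltaProd]
  exact congrArg List.prod (List.map_congr_left fun p _ => envHom_ι _)

/-- A combination of the spanning monomials in the kernel maps to a relation between independent
elements, hence has zero coefficients. Surjectivity is `span_deltaProd`. -/
theorem envHom_bijective : Function.Bijective (envHom I) := by
  constructor
  · refine (injective_iff_map_eq_zero _).2 fun u hu => ?_
    have h : u ∈ Submodule.span ℂ (Set.range
        fun s : Multiset {c : IsoClass I // c.Indecomposable} => envProd s.toList) := by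
      rw [span_envProd_toList]; trivial
    obtain ⟨w, rfl⟩ := (Finsupp.mem_span_range_iff_exists_finsupp).1 h
    have hw : w = 0 := by
      refine linearIndependent_iff.1 linearIndependent_deltaProd w ?_
      rw [Finsupp.linearCombination_apply, ← hu, map_finsuppSum]
      exact Finsupp.sum_congr fun s _ => by rw [map_smul, envHom_envProd]
    rw [hw, Finsupp.sum_zero_index]
  · refine (LinearMap.range_eq_top (f := (envHom I).toLinearMap)).1 ?_
    rw [eq_top_iff, ← span_deltaProd, Submodule.span_le]
    rintro _ ⟨l, rfl⟩
    exact ⟨envProd l, envHom_envProd l⟩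

/-- The homomorphism of bialgebras from the enveloping algebra that extends the inclusion. -/
noncomputable def envBialgHom (I : Type u) [Quiver.{v} I] [Finite I]
    [∀ i j : I, Finite (i ⟶ j)] :
    UniversalEnvelopingAlgebra ℂ (nilLie I) →ₐc[ℂ] HallAlgebra I :=
  BialgHom.ofAlgHom (envHom I)
    (by
      -- Both sides are algebra homomorphisms, so compatibility with the counit, and likewise with
      -- the coproduct, need only be checked on the Lie algebra.
      refine UniversalEnvelopingAlgebra.hom_ext ℂ (LieHom.ext fun x => ?_)
      change CoalgebraStruct.counit (R := ℂ) (envHom I (UniversalEnvelopingAlgebra.ι ℂ x)) =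
        UniversalEnvelopingAlgebra.counitHom ℂ (nilLie I) (UniversalEnvelopingAlgebra.ι ℂ x)
      rw [envHom_ι, UniversalEnvelopingAlgebra.counitHom_ι, counit_apply,
        apply_zero_of_mem_nilLie x.2])
    (by
      refine UniversalEnvelopingAlgebra.hom_ext ℂ (LieHom.ext fun x => ?_)
      change Algebra.TensorProduct.map (envHom I) (envHom I)
          (UniversalEnvelopingAlgebra.comulHom ℂ (nilLie I) (UniversalEnvelopingAlgebra.ι ℂ x)) =
        CoalgebraStruct.comul (R := ℂ) (envHom I (UniversalEnvelopingAlgebra.ι ℂ x))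
      rw [UniversalEnvelopingAlgebra.comulHom_ι, map_add, Algebra.TensorProduct.map_tmul,
        Algebra.TensorProduct.map_tmul, envHom_ι, map_one, mem_nilLie_iff.1 x.2])

end HallAlgebra


/-! ### The main theorem -/

theorem mainTheorem2 (I : Type u) [Quiver.{v} I] [Finite I] [∀ i j : I, Finite (i ⟶ j)] :
    -- `H` is a connected cocommutative Hopf algebra, graded by the effective cone of `K₀` and by
    -- dimension vectors
    (∃ S : HallAlgebra I →ₗ[ℂ] HallAlgebra I, IsAntipode ℂ S ∧
      IsConnectedHopfGrading S (HallAlgebra.piece (K0.coneCls (I := I))) ∧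
      IsConnectedHopfGrading S (HallAlgebra.piece (IsoClass.dimVec (I := I)))) ∧
    Coalgebra.IsCocomm ℂ (HallAlgebra I) ∧
    -- the primitive elements are spanned by the classes of indecomposable representations
    (HallAlgebra.nilLie I).toSubmodule = Submodule.span ℂ
      {f | ∃ M : F1Rep I, M.Indecomposable ∧ f = HallAlgebra.delta (IsoClass.mk M)} ∧
    IsProNilpotent (HallAlgebra.nilLie I) ∧
    -- `U(𝔫) ≃ H` as bialgebras (hence as Hopf algebras), extending the inclusion of `𝔫`
    ∃ e : UniversalEnvelopingAlgebra ℂ (HallAlgebra.nilLie I) ≃ₐc[ℂ] HallAlgebra I,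
      ∀ x : HallAlgebra.nilLie I, e (UniversalEnvelopingAlgebra.ι ℂ x) = x := by
  obtain ⟨S, hS, hSδ⟩ := HallAlgebra.exists_antipode (I := I)
  exact ⟨⟨S, hS, HallAlgebra.isConnectedHopfGrading_piece K0.isConnectedDegree_coneCls hSδ,
      HallAlgebra.isConnectedHopfGrading_piece IsoClass.isConnectedDegree_dimVec hSδ⟩,
    HallAlgebra.isCocomm, HallAlgebra.nilLie_eq_span, HallAlgebra.isProNilpotent_nilLie,
    BialgEquiv.ofBijective (HallAlgebra.envBialgHom I) HallAlgebra.envHom_bijective,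
    HallAlgebra.envHom_ι⟩
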